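/- **Types.** Polynomial functors are $P ::= \mathrm{Id} \mid \mathsf C_N \mid P+P \mid P\times P$ with constants $N ::= \mathsf{unit}\mid \mu P$ (the *normal base types*; $\mu P$ is the inductive data type that is the least fixed point of $P$). The ground types of the calculus $S_1^-$ are $\gamma ::= N\mid \gamma+\gamma\mid\gamma\times\gamma$. The ground types of the ramified calculus $RS_1^-$ have in addition a safe copy $N^{\mathsf S}$ of each $N$; a ground type is *normal* (resp. *safe*) if all its base types are normal (resp. safe); $\gamma^{\mathsf S}$ and $\gamma^{\mathsf N}$ are the safe and normal versions of $\gamma$. A ground type is *hereditarily sequential* if every polynomial functor occurring in it (at any depth) has degree at most $1$. Only types all of whose data types (at any depth) are inhabited occur in typing judgments. **The calculus $S_1^-$.** This is the first-order simply typed $\lambda$-calculus with variables and abstractions $\lambda x.e:\gamma_1\to\gamma_0$ over ground types, application, the unit value, pairs, projections, injections, case distinction, constructors $\mathsf c_{\mu P}:P(\mu P)\to\mu P$, destructors $\mathsf d_{\mu P}:\mu P\to P(\mu P)$, and structural recursion: $\mathsf{fold}_{\mu P}\,(\lambda x.e_0)\,e_1:\gamma$ if $\lambda x.e_0:P(\gamma)\to\gamma$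 and $e_1:\mu P$. *Values* are finite rooted directed acyclic graphs, possibly with sharing, with vertices labelled by the unit value, injections, pairing or constructors $\mathsf c_{\mu P}$; $\mathrm{size}(v)$ is the number of constructor vertices of $v$; two values are *bisimilar* if they unfold to the same tree. *Top-down* (TD) evaluation is the usual call-by-value big-step evaluation with environments, in which $\mathsf{fold}_{\mu P}\,f\,e$ is evaluated by evaluating $f(g(\mathsf d_{\mu P}\,e))$, where $g$ is the term obtained by simplifying the functorial action $P(\mathsf{fold}_{\mu P}\,f)$. The TD-*cost* of an evaluation is the number of nodes of its derivation tree. A closed $f:\gamma_1\to\gamma_0$ is *TD-poly-cost* if there is a polynomial $q$ such that, for every value $v$ of type $\gamma_1$, evaluating $f\,x$ in the environment $x\mapsto v$ has TD-cost at most $q(\mathrm{size}(v))$. **The calculus $RS_1^-$.** This has the terms, typing rules and evaluation rules of $S_1^-$ over the larger class of ground types, with the following changes. There are safe constructors $(P(\mu P))^{\mathsf S}\to(\mu P)^{\mathsf S}$ and safe destructors $(\mu P)^{\mathsf S}\to(P(\mu P))^{\mathsf S}$, evaluated like the normal ones. A case distinction on type $\gamma_1+\gamma_2$ with result type $\gamma$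 requires that $\gamma_1+\gamma_2$ is normal or $\gamma$ is safe. A fold has type $\gamma^{\mathsf S}$ and requires a step function $\lambda x.e_0:P(\gamma^{\mathsf S})\to\gamma^{\mathsf S}$ and an argument of the (normal) type $\mu P$. There are coercions, evaluated as the identity: $\mathsf{toSafe}\,e:\gamma^{\mathsf S}$ for every $e:\gamma$, and $\mathsf{toNorm}\,e:\gamma^{\mathsf N}$ for every $e:\gamma$ all of whose free variables have normal types. A function $f:\gamma_1\to\gamma_0$ between normal types is *$RS_1^-$-computable* if there is a closed $RS_1^-$-term $f':\gamma_1\to\gamma_0$ such that, for every value $v$ of type $\gamma_1$, the values of $f\,x$ and $f'\,x$ at $x\mapsto v$ are bisimilar. **Theorem.** Let $f:\gamma_1\to\gamma_0$ be a closed $S_1^-$-term, where $\gamma_1$ is normal and hereditarily sequential. If $f$ is TD-poly-cost, then $f$ is $RS_1^-$-computable. -/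

import Mathlib

namespace StructRec

/-! ### Types -/

/-- Polynomial functors `P ::= Id | C_N | P + P | P × P`, where the normal base types `N` are
`unit` and the data types `μ P`; `constMu P` is the constant functor at the data type `μ P`. -/
inductive Poly : Type
  | id : Poly
  | constUnit : Poly
  | constMu (P : Poly) : Poly
  | sum (P Q : Poly) : Poly
  | prod (P Q : Poly) : Poly

/-- Ground types of the ramified calculus: the normal base types `unit`, `μ P`, their safe
versions, sums and products. The ground types of the unramified calculus are the normal ones,
see `Ground.IsNormal`. -/
inductive Ground : Type
  | unit : Ground
  | mu (P : Poly) : Ground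
  | safeUnit : Ground
  | safeMu (P : Poly) : Ground
  | sum (γ₁ γ₂ : Ground) : Ground
  | prod (γ₁ γ₂ : Ground) : Ground

/-- Types: ground types and level-1 types between ground types. -/
inductive Ty : Type
  | ground (γ : Ground) : Ty
  | arrow (γ₁ γ₀ : Ground) : Ty

/-- All base types in `γ` are normal. -/
def Ground.IsNormal : Ground → Prop
  | .unit => True
  | .mu _ => True
  | .safeUnit => False
  | .safeMu _ => False
  | .sum γ₁ γ₂ => γ₁.IsNormal ∧ γ₂.IsNormal
  | .prod γ₁ γ₂ => γ₁.IsNormal ∧ γ₂.IsNormal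

/-- All base types in `γ` are safe. -/
def Ground.IsSafe : Ground → Prop
  | .unit => False
  | .mu _ => False
  | .safeUnit => True
  | .safeMu _ => True
  | .sum γ₁ γ₂ => γ₁.IsSafe ∧ γ₂.IsSafe
  | .prod γ₁ γ₂ => γ₁.IsSafe ∧ γ₂.IsSafe

/-- The safe version of a ground type. -/
def Ground.toSafe : Ground → Ground
  | .unit => .safeUnit
  | .mu P => .safeMu P
  | .safeUnit => .safeUnit
  | .safeMu P => .safeMu P
  | .sum γ₁ γ₂ => .sum γ₁.toSafe γ₂.toSafe
  | .prod γ₁ γ₂ => .prod γ₁.toSafe γ₂.toSafe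

/-- The normal version of a ground type. -/
def Ground.toNormal : Ground → Ground
  | .unit => .unit
  | .mu P => .mu P
  | .safeUnit => .unit
  | .safeMu P => .mu P
  | .sum γ₁ γ₂ => .sum γ₁.toNormal γ₂.toNormal
  | .prod γ₁ γ₂ => .prod γ₁.toNormal γ₂.toNormal

/-- The ground type `P(γ)`. -/
def Poly.app : Poly → Ground → Ground
  | .id, γ => γ
  | .constUnit, _ => .unit
  | .constMu Q, _ => .mu Q
  | .sum P Q, γ => .sum (P.app γ) (Q.app γ)
  | .prod P Q, γ => .prod (P.app γ) (Q.app γ)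

/-- Degree of `P(X)` as a polynomial in `X`. -/
def Poly.degree : Poly → ℕ
  | .id => 1
  | .constUnit => 0
  | .constMu _ => 0
  | .sum P Q => max P.degree Q.degree
  | .prod P Q => P.degree + Q.degree

/-- Every functor whose least fixed point occurs (at any depth) in `P` has degree at most 1. -/
def Poly.ConstsSequential : Poly → Prop
  | .id => True
  | .constUnit => True
  | .constMu Q => Q.degree ≤ 1 ∧ Q.ConstsSequential
  | .sum P Q => P.ConstsSequential ∧ Q.ConstsSequential
  | .prod P Q => P.ConstsSequential ∧ Q.ConstsSequential

/-- Each polynomial functor occurring within the ground type has degree at most 1. -/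
def Ground.HereditarilySequential : Ground → Prop
  | .unit => True
  | .mu P => P.degree ≤ 1 ∧ P.ConstsSequential
  | .safeUnit => True
  | .safeMu P => P.degree ≤ 1 ∧ P.ConstsSequential
  | .sum γ₁ γ₂ => γ₁.HereditarilySequential ∧ γ₂.HereditarilySequential
  | .prod γ₁ γ₂ => γ₁.HereditarilySequential ∧ γ₂.HereditarilySequential

/-! ### Value term graphs -/

/-- A vertex of a term graph: its label together with the targets of its out-edges. -/
inductive Node : Type
  | unit : Node
  | inl (a : ℕ) : Node
  | inr (a : ℕ) : Node
  | pair (a b : ℕ) : Node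
  | con (P : Poly) (a : ℕ) : Node

/-- A finite term graph; vertices are positions in the list. -/
abbrev Heap : Type := List Node

/-- `IsValue h γ a`: the part of `h` rooted at the vertex `a` is a value term graph of the
(normal) type `γ`. As the definition is inductive, that part is acyclic; vertices may be shared. -/
inductive IsValue (h : Heap) : Ground → ℕ → Prop
  | unit {a : ℕ} (ha : h[a]? = some .unit) : IsValue h .unit a
  | inl {γ₁ γ₂ : Ground} {a b : ℕ} (ha : h[a]? = some (.inl b)) (hb : IsValue h γ₁ b) :
      IsValue h (.sum γ₁ γ₂) a
  | inr {γ₁ γ₂ : Ground} {a b : ℕ} (ha : h[a]? = some (.inr b)) (hb : IsValue h γ₂ b) :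
      IsValue h (.sum γ₁ γ₂) a
  | pair {γ₁ γ₂ : Ground} {a b c : ℕ} (ha : h[a]? = some (.pair b c))
      (hb : IsValue h γ₁ b) (hc : IsValue h γ₂ c) : IsValue h (.prod γ₁ γ₂) a
  | con {P : Poly} {a b : ℕ} (ha : h[a]? = some (.con P b))
      (hb : IsValue h (P.app (.mu P)) b) : IsValue h (.mu P) a

/-- Bisimilarity of the value at vertex `a` of `h` and the value at vertex `a'` of `h'`. -/
inductive Bisim (h h' : Heap) : Ground → ℕ → ℕ → Prop
  | unit {a a' : ℕ} (ha : h[a]? = some .unit) (ha' : h'[a']? = some .unit) :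
      Bisim h h' .unit a a'
  | inl {γ₁ γ₂ : Ground} {a a' b b' : ℕ} (ha : h[a]? = some (.inl b))
      (ha' : h'[a']? = some (.inl b')) (hb : Bisim h h' γ₁ b b') :
      Bisim h h' (.sum γ₁ γ₂) a a'
  | inr {γ₁ γ₂ : Ground} {a a' b b' : ℕ} (ha : h[a]? = some (.inr b))
      (ha' : h'[a']? = some (.inr b')) (hb : Bisim h h' γ₂ b b') :
      Bisim h h' (.sum γ₁ γ₂) a a'
  | pair {γ₁ γ₂ : Ground} {a a' b b' c c' : ℕ} (ha : h[a]? = some (.pair b c))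
      (ha' : h'[a']? = some (.pair b' c')) (hb : Bisim h h' γ₁ b b')
      (hc : Bisim h h' γ₂ c c') : Bisim h h' (.prod γ₁ γ₂) a a'
  | con {P : Poly} {a a' b b' : ℕ} (ha : h[a]? = some (.con P b))
      (ha' : h'[a']? = some (.con P b')) (hb : Bisim h h' (P.app (.mu P)) b b') :
      Bisim h h' (.mu P) a a'

/-- `h.Edge a b`: the vertex `a` has an out-edge to `b`. -/
inductive Heap.Edge (h : Heap) : ℕ → ℕ → Prop
  | inl {a b : ℕ} (ha : h[a]? = some (.inl b)) : Heap.Edge h a b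
  | inr {a b : ℕ} (ha : h[a]? = some (.inr b)) : Heap.Edge h a b
  | fst {a b c : ℕ} (ha : h[a]? = some (.pair b c)) : Heap.Edge h a b
  | snd {a b c : ℕ} (ha : h[a]? = some (.pair b c)) : Heap.Edge h a c
  | con {P : Poly} {a b : ℕ} (ha : h[a]? = some (.con P b)) : Heap.Edge h a b

/-- The size of the value rooted at `a`: its number of data-type constructor vertices
(shared vertices are counted once). -/
noncomputable def Heap.size (h : Heap) (a : ℕ) : ℕ :=
  Set.ncard {b : ℕ | Relation.ReflTransGen h.Edge a b ∧
    ∃ (P : Poly) (c : ℕ), h[b]? = some (.con P c)}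

/-! ### Inhabitation -/

/-- The data type `μ P` is inhabited. -/
def Poly.MuInhabited (P : Poly) : Prop := ∃ (h : Heap) (a : ℕ), IsValue h (.mu P) a

/-- Every data type occurring (at any depth) in `P` is inhabited. -/
def Poly.ConstsInhabited : Poly → Prop
  | .id => True
  | .constUnit => True
  | .constMu Q => Q.MuInhabited ∧ Q.ConstsInhabited
  | .sum P Q => P.ConstsInhabited ∧ Q.ConstsInhabited
  | .prod P Q => P.ConstsInhabited ∧ Q.ConstsInhabited

/-- Ground types admitted in typing judgments: every data type occurring in them is inhabited. -/
def Ground.Admissible : Ground → Prop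
  | .unit => True
  | .mu P => P.MuInhabited ∧ P.ConstsInhabited
  | .safeUnit => True
  | .safeMu P => P.MuInhabited ∧ P.ConstsInhabited
  | .sum γ₁ γ₂ => γ₁.Admissible ∧ γ₂.Admissible
  | .prod γ₁ γ₂ => γ₁.Admissible ∧ γ₂.Admissible

/-! ### Terms -/

/-- Raw terms, with de Bruijn indices for variables. `lam` and the two branches of `case` bind
one variable each. The last four constructors belong to the ramified calculus only. -/
inductive Term : Type
  | var (i : ℕ) : Term
  | lam (e : Term) : Term
  | app (e₀ e₁ : Term) : Term
  | unit : Term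
  | pair (e₁ e₂ : Term) : Term
  | fst (e : Term) : Term
  | snd (e : Term) : Term
  | inl (e : Term) : Term
  | inr (e : Term) : Term
  | case (e₀ e₁ e₂ : Term) : Term
  | con (P : Poly) (e : Term) : Term
  | destr (P : Poly) (e : Term) : Term
  | fold (P : Poly) (f e : Term) : Term
  | safeCon (P : Poly) (e : Term) : Term
  | safeDestr (P : Poly) (e : Term) : Term
  | toSafe (e : Term) : Term
  | toNorm (e : Term) : Term

/-- Lift a renaming under a binder. -/
def liftRen (ρ : ℕ → ℕ) : ℕ → ℕ
  | 0 => 0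
  | i + 1 => ρ i + 1

/-- Capture-avoiding renaming of free variables. -/
def Term.rename : (ℕ → ℕ) → Term → Term
  | ρ, .var i => .var (ρ i)
  | ρ, .lam e => .lam (e.rename (liftRen ρ))
  | ρ, .app e₀ e₁ => .app (e₀.rename ρ) (e₁.rename ρ)
  | _, .unit => .unit
  | ρ, .pair e₁ e₂ => .pair (e₁.rename ρ) (e₂.rename ρ)
  | ρ, .fst e => .fst (e.rename ρ)
  | ρ, .snd e => .snd (e.rename ρ)
  | ρ, .inl e => .inl (e.rename ρ)
  | ρ, .inr e => .inr (e.rename ρ)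
  | ρ, .case e₀ e₁ e₂ =>
      .case (e₀.rename ρ) (e₁.rename (liftRen ρ)) (e₂.rename (liftRen ρ))
  | ρ, .con P e => .con P (e.rename ρ)
  | ρ, .destr P e => .destr P (e.rename ρ)
  | ρ, .fold P f e => .fold P (f.rename ρ) (e.rename ρ)
  | ρ, .safeCon P e => .safeCon P (e.rename ρ)
  | ρ, .safeDestr P e => .safeDestr P (e.rename ρ)
  | ρ, .toSafe e => .toSafe (e.rename ρ)
  | ρ, .toNorm e => .toNorm (e.rename ρ)

/-- The term, viewed in a context with one more (innermost) variable. -/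
def Term.shift (e : Term) : Term := e.rename Nat.succ

/-- The variable `i` occurs free in the term. -/
def Term.FreeIn (i : ℕ) : Term → Prop
  | .var j => j = i
  | .lam e => e.FreeIn (i + 1)
  | .app e₀ e₁ => e₀.FreeIn i ∨ e₁.FreeIn i
  | .unit => False
  | .pair e₁ e₂ => e₁.FreeIn i ∨ e₂.FreeIn i
  | .fst e => e.FreeIn i
  | .snd e => e.FreeIn i
  | .inl e => e.FreeIn i
  | .inr e => e.FreeIn i
  | .case e₀ e₁ e₂ => e₀.FreeIn i ∨ e₁.FreeIn (i + 1) ∨ e₂.FreeIn (i + 1)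
  | .con _ e => e.FreeIn i
  | .destr _ e => e.FreeIn i
  | .fold _ f e => f.FreeIn i ∨ e.FreeIn i
  | .safeCon _ e => e.FreeIn i
  | .safeDestr _ e => e.FreeIn i
  | .toSafe e => e.FreeIn i
  | .toNorm e => e.FreeIn i

/-! ### Typing -/

/-- Typing contexts: the types of the de Bruijn variables, innermost first. -/
abbrev Ctx : Type := List Ground

/-- Ground types of the unramified calculus. -/
def Ground.IsSType (γ : Ground) : Prop := γ.IsNormal ∧ γ.Admissible

/-- Typing rules of the unramified calculus of structural recursions. -/
inductive STyping : Ctx → Term → Ty → Prop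
  | var {Γ : Ctx} {i : ℕ} {γ : Ground} (hγ : γ.IsSType) (hi : Γ[i]? = some γ) :
      STyping Γ (.var i) (.ground γ)
  | lam {Γ : Ctx} {e : Term} {γ₁ γ₀ : Ground} (hγ : γ₁.IsSType)
      (he : STyping (γ₁ :: Γ) e (.ground γ₀)) : STyping Γ (.lam e) (.arrow γ₁ γ₀)
  | app {Γ : Ctx} {e₀ e₁ : Term} {γ₁ γ₀ : Ground} (h₀ : STyping Γ e₀ (.arrow γ₁ γ₀))
      (h₁ : STyping Γ e₁ (.ground γ₁)) : STyping Γ (.app e₀ e₁) (.ground γ₀)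
  | unit {Γ : Ctx} : STyping Γ .unit (.ground .unit)
  | pair {Γ : Ctx} {e₁ e₂ : Term} {γ₁ γ₂ : Ground} (h₁ : STyping Γ e₁ (.ground γ₁))
      (h₂ : STyping Γ e₂ (.ground γ₂)) : STyping Γ (.pair e₁ e₂) (.ground (.prod γ₁ γ₂))
  | fst {Γ : Ctx} {e : Term} {γ₁ γ₂ : Ground} (h : STyping Γ e (.ground (.prod γ₁ γ₂))) :
      STyping Γ (.fst e) (.ground γ₁)
  | snd {Γ : Ctx} {e : Term} {γ₁ γ₂ : Ground} (h : STyping Γ e (.ground (.prod γ₁ γ₂))) :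
      STyping Γ (.snd e) (.ground γ₂)
  | inl {Γ : Ctx} {e : Term} {γ₁ γ₂ : Ground} (hγ : γ₂.IsSType)
      (h : STyping Γ e (.ground γ₁)) : STyping Γ (.inl e) (.ground (.sum γ₁ γ₂))
  | inr {Γ : Ctx} {e : Term} {γ₁ γ₂ : Ground} (hγ : γ₁.IsSType)
      (h : STyping Γ e (.ground γ₂)) : STyping Γ (.inr e) (.ground (.sum γ₁ γ₂))
  | case {Γ : Ctx} {e₀ e₁ e₂ : Term} {γ₁ γ₂ γ : Ground}
      (h₀ : STyping Γ e₀ (.ground (.sum γ₁ γ₂))) (h₁ : STyping (γ₁ :: Γ) e₁ (.ground γ))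
      (h₂ : STyping (γ₂ :: Γ) e₂ (.ground γ)) : STyping Γ (.case e₀ e₁ e₂) (.ground γ)
  | con {Γ : Ctx} {P : Poly} {e : Term} (hP : (Ground.mu P).IsSType)
      (h : STyping Γ e (.ground (P.app (.mu P)))) : STyping Γ (.con P e) (.ground (.mu P))
  | destr {Γ : Ctx} {P : Poly} {e : Term} (h : STyping Γ e (.ground (.mu P))) :
      STyping Γ (.destr P e) (.ground (P.app (.mu P)))
  | fold {Γ : Ctx} {P : Poly} {e₀ e₁ : Term} {γ : Ground}
      (h₀ : STyping Γ (.lam e₀) (.arrow (P.app γ) γ)) (h₁ : STyping Γ e₁ (.ground (.mu P))) :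
      STyping Γ (.fold P (.lam e₀) e₁) (.ground γ)

/-- Typing rules of the ramified calculus. -/
inductive RSTyping : Ctx → Term → Ty → Prop
  | var {Γ : Ctx} {i : ℕ} {γ : Ground} (hγ : γ.Admissible) (hi : Γ[i]? = some γ) :
      RSTyping Γ (.var i) (.ground γ)
  | lam {Γ : Ctx} {e : Term} {γ₁ γ₀ : Ground} (hγ : γ₁.Admissible)
      (he : RSTyping (γ₁ :: Γ) e (.ground γ₀)) : RSTyping Γ (.lam e) (.arrow γ₁ γ₀)
  | app {Γ : Ctx} {e₀ e₁ : Term} {γ₁ γ₀ : Ground} (h₀ : RSTyping Γ e₀ (.arrow γ₁ γ₀))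
      (h₁ : RSTyping Γ e₁ (.ground γ₁)) : RSTyping Γ (.app e₀ e₁) (.ground γ₀)
  | unit {Γ : Ctx} : RSTyping Γ .unit (.ground .unit)
  | pair {Γ : Ctx} {e₁ e₂ : Term} {γ₁ γ₂ : Ground} (h₁ : RSTyping Γ e₁ (.ground γ₁))
      (h₂ : RSTyping Γ e₂ (.ground γ₂)) : RSTyping Γ (.pair e₁ e₂) (.ground (.prod γ₁ γ₂))
  | fst {Γ : Ctx} {e : Term} {γ₁ γ₂ : Ground} (h : RSTyping Γ e (.ground (.prod γ₁ γ₂))) :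
      RSTyping Γ (.fst e) (.ground γ₁)
  | snd {Γ : Ctx} {e : Term} {γ₁ γ₂ : Ground} (h : RSTyping Γ e (.ground (.prod γ₁ γ₂))) :
      RSTyping Γ (.snd e) (.ground γ₂)
  | inl {Γ : Ctx} {e : Term} {γ₁ γ₂ : Ground} (hγ : γ₂.Admissible)
      (h : RSTyping Γ e (.ground γ₁)) : RSTyping Γ (.inl e) (.ground (.sum γ₁ γ₂))
  | inr {Γ : Ctx} {e : Term} {γ₁ γ₂ : Ground} (hγ : γ₁.Admissible)
      (h : RSTyping Γ e (.ground γ₂)) : RSTyping Γ (.inr e) (.ground (.sum γ₁ γ₂))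
  | case {Γ : Ctx} {e₀ e₁ e₂ : Term} {γ₁ γ₂ γ : Ground}
      (hside : (Ground.sum γ₁ γ₂).IsNormal ∨ γ.IsSafe)
      (h₀ : RSTyping Γ e₀ (.ground (.sum γ₁ γ₂))) (h₁ : RSTyping (γ₁ :: Γ) e₁ (.ground γ))
      (h₂ : RSTyping (γ₂ :: Γ) e₂ (.ground γ)) : RSTyping Γ (.case e₀ e₁ e₂) (.ground γ)
  | con {Γ : Ctx} {P : Poly} {e : Term} (hP : (Ground.mu P).Admissible)
      (h : RSTyping Γ e (.ground (P.app (.mu P)))) : RSTyping Γ (.con P e) (.ground (.mu P))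
  | destr {Γ : Ctx} {P : Poly} {e : Term} (h : RSTyping Γ e (.ground (.mu P))) :
      RSTyping Γ (.destr P e) (.ground (P.app (.mu P)))
  | fold {Γ : Ctx} {P : Poly} {e₀ e₁ : Term} {γ : Ground}
      (h₀ : RSTyping Γ (.lam e₀) (.arrow (P.app γ.toSafe) γ.toSafe))
      (h₁ : RSTyping Γ e₁ (.ground (.mu P))) :
      RSTyping Γ (.fold P (.lam e₀) e₁) (.ground γ.toSafe)
  | safeCon {Γ : Ctx} {P : Poly} {e : Term} (hP : (Ground.safeMu P).Admissible)
      (h : RSTyping Γ e (.ground (P.app (.mu P)).toSafe)) :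
      RSTyping Γ (.safeCon P e) (.ground (.safeMu P))
  | safeDestr {Γ : Ctx} {P : Poly} {e : Term} (h : RSTyping Γ e (.ground (.safeMu P))) :
      RSTyping Γ (.safeDestr P e) (.ground (P.app (.mu P)).toSafe)
  | toSafe {Γ : Ctx} {e : Term} {γ : Ground} (h : RSTyping Γ e (.ground γ)) :
      RSTyping Γ (.toSafe e) (.ground γ.toSafe)
  | toNorm {Γ : Ctx} {e : Term} {γ : Ground}
      (hside : ∀ (i : ℕ) (γ' : Ground), e.FreeIn i → Γ[i]? = some γ' → γ'.IsNormal)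
      (h : RSTyping Γ e (.ground γ)) : RSTyping Γ (.toNorm e) (.ground γ.toNormal)

/-! ### Evaluation -/

/-- The simplified application `(Q (fold_{μP} f)) t`, where `Q` acts as a functor:
`(Id F) t` is `F t`, `(C F) t` is `(λ x. x) t`,
`((Q₁ × Q₂) F) t` is `(λ x. ((Q₁ F) (π₁ x), (Q₂ F) (π₂ x))) t`, and `((Q₁ + Q₂) F) t` is
`(λ x. case x of ι₁ x₁ ⇒ ι₁ ((Q₁ F) x₁); ι₂ x₂ ⇒ ι₂ ((Q₂ F) x₂)) t`. -/
def Poly.mapFold (P : Poly) : Poly → Term → Term → Term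
  | .id, f, t => .fold P f t
  | .constUnit, _, t => .app (.lam (.var 0)) t
  | .constMu _, _, t => .app (.lam (.var 0)) t
  | .prod Q₁ Q₂, f, t =>
      .app (.lam (.pair (Poly.mapFold P Q₁ f.shift (.fst (.var 0)))
        (Poly.mapFold P Q₂ f.shift (.snd (.var 0))))) t
  | .sum Q₁ Q₂, f, t =>
      .app (.lam (.case (.var 0)
        (.inl (Poly.mapFold P Q₁ f.shift.shift (.var 0)))
        (.inr (Poly.mapFold P Q₂ f.shift.shift (.var 0))))) t

/-- Top-down evaluation. `Eval e θ h v h' n`: in the environment `θ` (the vertices, in the term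
graph `h`, that are the values of the variables), `e` evaluates to the value at vertex `v` of the
term graph `h'`, which extends `h` by the vertices created on the way, by an evaluation
derivation with exactly `n` nodes. -/
inductive Eval : Term → List ℕ → Heap → ℕ → Heap → ℕ → Prop
  | var {i : ℕ} {θ : List ℕ} {h : Heap} {v : ℕ} (hi : θ[i]? = some v) :
      Eval (.var i) θ h v h 1
  | app {e₀ e₁ : Term} {θ : List ℕ} {h h₁ h₂ : Heap} {v₁ v n₁ n₀ : ℕ}
      (d₁ : Eval e₁ θ h v₁ h₁ n₁) (d₀ : Eval e₀ (v₁ :: θ) h₁ v h₂ n₀) :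
      Eval (.app (.lam e₀) e₁) θ h v h₂ (n₁ + n₀ + 1)
  | unit {θ : List ℕ} {h : Heap} : Eval .unit θ h h.length (h ++ [.unit]) 1
  | pair {e₁ e₂ : Term} {θ : List ℕ} {h h₁ h₂ : Heap} {v₁ v₂ n₁ n₂ : ℕ}
      (d₁ : Eval e₁ θ h v₁ h₁ n₁) (d₂ : Eval e₂ θ h₁ v₂ h₂ n₂) :
      Eval (.pair e₁ e₂) θ h h₂.length (h₂ ++ [.pair v₁ v₂]) (n₁ + n₂ + 1)
  | fst {e : Term} {θ : List ℕ} {h h₁ : Heap} {v v₁ v₂ n : ℕ}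
      (d : Eval e θ h v h₁ n) (hv : h₁[v]? = some (.pair v₁ v₂)) :
      Eval (.fst e) θ h v₁ h₁ (n + 1)
  | snd {e : Term} {θ : List ℕ} {h h₁ : Heap} {v v₁ v₂ n : ℕ}
      (d : Eval e θ h v h₁ n) (hv : h₁[v]? = some (.pair v₁ v₂)) :
      Eval (.snd e) θ h v₂ h₁ (n + 1)
  | inl {e : Term} {θ : List ℕ} {h h₁ : Heap} {v n : ℕ} (d : Eval e θ h v h₁ n) :
      Eval (.inl e) θ h h₁.length (h₁ ++ [.inl v]) (n + 1)
  | inr {e : Term} {θ : List ℕ} {h h₁ : Heap} {v n : ℕ} (d : Eval e θ h v h₁ n) :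
      Eval (.inr e) θ h h₁.length (h₁ ++ [.inr v]) (n + 1)
  | caseInl {e₀ e₁ e₂ : Term} {θ : List ℕ} {h h₀ h₁ : Heap} {v₀ w v n₀ n : ℕ}
      (d₀ : Eval e₀ θ h v₀ h₀ n₀) (hv : h₀[v₀]? = some (.inl w))
      (d : Eval e₁ (w :: θ) h₀ v h₁ n) :
      Eval (.case e₀ e₁ e₂) θ h v h₁ (n₀ + n + 1)
  | caseInr {e₀ e₁ e₂ : Term} {θ : List ℕ} {h h₀ h₁ : Heap} {v₀ w v n₀ n : ℕ}
      (d₀ : Eval e₀ θ h v₀ h₀ n₀) (hv : h₀[v₀]? = some (.inr w))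
      (d : Eval e₂ (w :: θ) h₀ v h₁ n) :
      Eval (.case e₀ e₁ e₂) θ h v h₁ (n₀ + n + 1)
  | con {P : Poly} {e : Term} {θ : List ℕ} {h h₁ : Heap} {v n : ℕ}
      (d : Eval e θ h v h₁ n) :
      Eval (.con P e) θ h h₁.length (h₁ ++ [.con P v]) (n + 1)
  | destr {P : Poly} {e : Term} {θ : List ℕ} {h h₁ : Heap} {v w n : ℕ}
      (d : Eval e θ h v h₁ n) (hv : h₁[v]? = some (.con P w)) :
      Eval (.destr P e) θ h w h₁ (n + 1)
  | fold {P : Poly} {f e : Term} {θ : List ℕ} {h h₁ : Heap} {v n : ℕ}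
      (d : Eval (.app f (Poly.mapFold P P f (.destr P e))) θ h v h₁ n) :
      Eval (.fold P f e) θ h v h₁ (n + 1)
  | safeCon {P : Poly} {e : Term} {θ : List ℕ} {h h₁ : Heap} {v n : ℕ}
      (d : Eval e θ h v h₁ n) :
      Eval (.safeCon P e) θ h h₁.length (h₁ ++ [.con P v]) (n + 1)
  | safeDestr {P : Poly} {e : Term} {θ : List ℕ} {h h₁ : Heap} {v w n : ℕ}
      (d : Eval e θ h v h₁ n) (hv : h₁[v]? = some (.con P w)) :
      Eval (.safeDestr P e) θ h w h₁ (n + 1)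
  | toSafe {e : Term} {θ : List ℕ} {h h₁ : Heap} {v n : ℕ} (d : Eval e θ h v h₁ n) :
      Eval (.toSafe e) θ h v h₁ (n + 1)
  | toNorm {e : Term} {θ : List ℕ} {h h₁ : Heap} {v n : ℕ} (d : Eval e θ h v h₁ n) :
      Eval (.toNorm e) θ h v h₁ (n + 1)

/-- The closed function term `f`, with arguments of type `γ₁`, has polynomial cost under top-down
evaluation: there is a polynomial `q` such that on every argument `a`, shared or not, the
evaluation of `f x` at `x ↦ a` has a derivation with at most `q (size a)` nodes. -/
def TDPolyCost (f : Term) (γ₁ : Ground) : Prop :=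
  ∃ q : Polynomial ℕ, ∀ (h : Heap) (a : ℕ), IsValue h γ₁ a →
    ∃ (v : ℕ) (h' : Heap) (n : ℕ),
      Eval (.app f (.var 0)) [a] h v h' n ∧ n ≤ q.eval (h.size a)

/-- The function `γ₁ → γ₀` defined by the closed term `f` is computed by a closed term `f'` of
the ramified calculus, of the same type `γ₁ → γ₀`: on every argument both evaluate, and to
bisimilar values. -/
def RSComputable (f : Term) (γ₁ γ₀ : Ground) : Prop :=
  ∃ f' : Term, RSTyping [] f' (.arrow γ₁ γ₀) ∧
    ∀ (h : Heap) (a : ℕ), IsValue h γ₁ a →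
      ∃ (v : ℕ) (k : Heap) (n : ℕ) (v' : ℕ) (k' : Heap) (n' : ℕ),
        Eval (.app f (.var 0)) [a] h v k n ∧
        Eval (.app f' (.var 0)) [a] h v' k' n' ∧
        Bisim k k' γ₀ v v'

end StructRec

namespace StructRec

/-! ### Trees -/

/-! An evaluation spends at least one node on each call of a structural recursion, so a polynomial
bound on the cost of `f` bounds the length of every recursion that `f` executes. The folds of `f`
cannot simply be kept: a ramified fold needs a normal argument and returns a safe result, whereas
folds of `f` may run on results of other folds. Instead all data of `f` become safe, and a single
normal numeral, the clock, is computed beforehand from the argument and drives every loop.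

The clock. On a hereditarily sequential type, folds that thread a safe counter compute the number of
constructors of the unfolded argument (`Ground.addsConCount`). Each step receives at most one
recursive result, so two safe counters never have to be added. The argument is the only variable and
is normal, so the count can be coerced to a normal numeral, to which the cost polynomial is applied
(`RSFun.polynomial`). Unfolding only increases the number of constructors (`Rep.size_le`), so the
clock bounds the cost.

The simulation. A fold over safe data becomes two loops driven by the clock
(`RSFun.exists_safeFold`). One lists in preorder all subtrees on which the fold is called; the other
runs through this list backwards with a stack, replacing the values of the children of a tree by the
value of the tree. Both inspect safe data only by destructors and by case distinctions with safe
results, which ramification permits. By induction on typing, a term is simulated correctly whenever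
the clock is at least `Term.foldBound` (`STyping.exists_rsFun`).

Syntax and semantics are linked by `ETyping.evaluatesAt`: typed terms of either calculus evaluate to
their denotation on trees, at a cost of at least `foldBound`. The cost of the ramified term plays no
role. -/

/-- The unfolding of a value term graph. -/
inductive Tree : Type
  | unit : Tree
  | inl (t : Tree) : Tree
  | inr (t : Tree) : Tree
  | pair (t u : Tree) : Tree
  | con (P : Poly) (t : Tree) : Tree

namespace Tree

/-- First projection. -/
def fst : Tree → Tree
  | pair t _ => t
  | _ => unit

/-- Second projection. -/
def snd : Tree → Tree
  | pair _ t => t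
  | _ => unit

/-- The argument of a constructor. -/
def destr : Tree → Tree
  | con _ t => t
  | _ => unit

/-- Case distinction. -/
def caseOf : Tree → (Tree → Tree) → (Tree → Tree) → Tree
  | inl t, f, _ => f t
  | inr t, _, g => g t
  | _, _, _ => unit

/-- The functorial action of `Q` at the fold over `μ P` with step function `g`; for `Q = Id` it is
the fold itself. -/
def mapFold (P : Poly) (g : Tree → Tree) : Poly → Tree → Tree
  | .id, con _ t => g (mapFold P g P t)
  | .sum Q _, inl t => inl (mapFold P g Q t)
  | .sum _ Q, inr t => inr (mapFold P g Q t)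
  | .prod Q₁ Q₂, pair t u => pair (mapFold P g Q₁ t) (mapFold P g Q₂ u)
  | _, t => t

/-- The subtrees visited by `mapFold`, in preorder. -/
def preorder (P : Poly) : Poly → Tree → List Tree
  | .id, con c t => con c t :: preorder P P t
  | .sum Q _, inl t => preorder P Q t
  | .sum _ Q, inr t => preorder P Q t
  | .prod Q₁ Q₂, pair t u => preorder P Q₁ t ++ preorder P Q₂ u
  | _, _ => []

/-- The largest value of `B` on the arguments that `mapFold` passes to the step function. -/
def foldSup (P : Poly) (g : Tree → Tree) (B : Tree → ℕ) : Poly → Tree → ℕ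
  | .id, con _ t => max (foldSup P g B P t) (B (mapFold P g P t))
  | .sum Q _, inl t => foldSup P g B Q t
  | .sum _ Q, inr t => foldSup P g B Q t
  | .prod Q₁ Q₂, pair t u => max (foldSup P g B Q₁ t) (foldSup P g B Q₂ u)
  | _, _ => 0

/-- The number of data-type constructors of a tree. -/
def conCount : Tree → ℕ
  | unit => 0
  | inl t => conCount t
  | inr t => conCount t
  | pair t u => conCount t + conCount u
  | con _ t => conCount t + 1

/-- `t.HasTy γ`: the tree `t` is a value of type `γ`; normal and safe types are not
distinguished. -/
def HasTy : Tree → Ground → Prop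
  | unit, .unit => True
  | unit, .safeUnit => True
  | inl t, .sum γ _ => HasTy t γ
  | inr t, .sum _ γ => HasTy t γ
  | pair t u, .prod γ₁ γ₂ => HasTy t γ₁ ∧ HasTy u γ₂
  | con P t, .mu Q => P = Q ∧ HasTy t (Q.app (.mu Q))
  | con P t, .safeMu Q => P = Q ∧ HasTy t (Q.app (.mu Q))
  | _, _ => False

/-! ### Typed trees and folds on them. -/

theorem hasTy_unit_iff {t : Tree} : t.HasTy .unit ↔ t = unit := by
  cases t <;> simp [HasTy]

theorem hasTy_safeUnit_iff {t : Tree} : t.HasTy .safeUnit ↔ t = unit := by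
  cases t <;> simp [HasTy]

theorem hasTy_sum_iff {t : Tree} {γ₁ γ₂ : Ground} : t.HasTy (.sum γ₁ γ₂) ↔
    (∃ u, t = inl u ∧ u.HasTy γ₁) ∨ ∃ u, t = inr u ∧ u.HasTy γ₂ := by
  cases t <;> simp [HasTy]

theorem hasTy_prod_iff {t : Tree} {γ₁ γ₂ : Ground} : t.HasTy (.prod γ₁ γ₂) ↔
    ∃ u v, t = pair u v ∧ u.HasTy γ₁ ∧ v.HasTy γ₂ := by
  cases t <;> simp [HasTy]

theorem hasTy_mu_iff {t : Tree} {P : Poly} : t.HasTy (.mu P) ↔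
    ∃ u, t = con P u ∧ u.HasTy (P.app (.mu P)) := by
  cases t <;> simp [HasTy]

theorem hasTy_safeMu_iff {t : Tree} {P : Poly} : t.HasTy (.safeMu P) ↔
    ∃ u, t = con P u ∧ u.HasTy (P.app (.mu P)) := by
  cases t <;> simp [HasTy]

@[simp] theorem hasTy_toSafe {t : Tree} {γ : Ground} : t.HasTy γ.toSafe ↔ t.HasTy γ := by
  induction γ generalizing t <;>
    simp_all [Ground.toSafe, hasTy_unit_iff, hasTy_safeUnit_iff, hasTy_sum_iff, hasTy_prod_iff,
      hasTy_mu_iff, hasTy_safeMu_iff]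

@[simp] theorem hasTy_toNormal {t : Tree} {γ : Ground} : t.HasTy γ.toNormal ↔ t.HasTy γ := by
  induction γ generalizing t <;>
    simp_all [Ground.toNormal, hasTy_unit_iff, hasTy_safeUnit_iff, hasTy_sum_iff, hasTy_prod_iff,
      hasTy_mu_iff, hasTy_safeMu_iff]

/-- The induction is on the tree, for all `Q` at once, because a constructor resets the functor from
`Id` to `P`. Other proofs about `mapFold` follow the same pattern. -/
theorem hasTy_mapFold {P : Poly} {g : Tree → Tree} {σ : Ground}
    (hg : ∀ x, x.HasTy (P.app σ) → (g x).HasTy σ) (t : Tree) : ∀ Q : Poly,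
    t.HasTy (Q.app (.mu P)) → (mapFold P g Q t).HasTy (Q.app σ) := by
  induction t <;> intro Q <;> cases Q <;> simp_all [HasTy, Poly.app, mapFold]

theorem mapFold_congr {P : Poly} {f g : Tree → Tree} {σ : Ground}
    (hg : ∀ x, x.HasTy (P.app σ) → (g x).HasTy σ)
    (hfg : ∀ x, x.HasTy (P.app σ) → f x = g x) (t : Tree) : ∀ Q : Poly,
    t.HasTy (Q.app (.mu P)) → mapFold P f Q t = mapFold P g Q t := by
  induction t with
  | con c t ih =>
    intro Q hQ
    cases Q <;> simp_all [HasTy, Poly.app, mapFold]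
    exact hfg _ (hasTy_mapFold hg t P hQ.2)
  | _ => intro Q; cases Q <;> simp_all [HasTy, Poly.app, mapFold]

/-- Two step functions that agree on the bounded arguments define the same fold, as long as all
arguments that arise are bounded. -/
theorem mapFold_congr_of_foldSup_le {P : Poly} {f g : Tree → Tree} {σ : Ground} {B : Tree → ℕ}
    {n : ℕ} (hg : ∀ x, x.HasTy (P.app σ) → (g x).HasTy σ)
    (hfg : ∀ x, x.HasTy (P.app σ) → B x ≤ n → f x = g x) (t : Tree) : ∀ Q : Poly,
    t.HasTy (Q.app (.mu P)) → foldSup P g B Q t ≤ n → mapFold P f Q t = mapFold P g Q t := by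
  induction t with
  | con c t ih =>
    intro Q hQ
    cases Q <;> simp_all [HasTy, Poly.app, mapFold, foldSup]
    exact fun _ h => hfg _ (hasTy_mapFold hg t P hQ.2) h
  | _ => intro Q; cases Q <;> simp_all [HasTy, Poly.app, mapFold, foldSup]

end Tree

/-! ### Denotations of terms -/

/-- The denotation of a term as a function of the trees for its variables. A function term takes
its argument as an additional, innermost variable. -/
def Term.den : Term → List Tree → Tree
  | .var i, ρ => ρ[i]?.getD .unit
  | .lam e, ρ => e.den ρ
  | .app e₀ e₁, ρ => e₀.den (e₁.den ρ :: ρ)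
  | .unit, _ => .unit
  | .pair e₁ e₂, ρ => .pair (e₁.den ρ) (e₂.den ρ)
  | .fst e, ρ => (e.den ρ).fst
  | .snd e, ρ => (e.den ρ).snd
  | .inl e, ρ => .inl (e.den ρ)
  | .inr e, ρ => .inr (e.den ρ)
  | .case e₀ e₁ e₂, ρ => (e₀.den ρ).caseOf (fun x => e₁.den (x :: ρ)) (fun x => e₂.den (x :: ρ))
  | .con P e, ρ => .con P (e.den ρ)
  | .destr _ e, ρ => (e.den ρ).destr
  | .fold P f e, ρ => (e.den ρ).mapFold P (fun x => f.den (x :: ρ)) .id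
  | .safeCon P e, ρ => .con P (e.den ρ)
  | .safeDestr _ e, ρ => (e.den ρ).destr
  | .toSafe e, ρ => e.den ρ
  | .toNorm e, ρ => e.den ρ

/-- A bound for the lengths of all structural recursions executed by a term. -/
def Term.foldBound : Term → List Tree → ℕ
  | .var _, _ => 0
  | .lam e, ρ => e.foldBound ρ
  | .app e₀ e₁, ρ => max (e₁.foldBound ρ) (e₀.foldBound (e₁.den ρ :: ρ))
  | .unit, _ => 0
  | .pair e₁ e₂, ρ => max (e₁.foldBound ρ) (e₂.foldBound ρ)
  | .fst e, ρ => e.foldBound ρ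
  | .snd e, ρ => e.foldBound ρ
  | .inl e, ρ => e.foldBound ρ
  | .inr e, ρ => e.foldBound ρ
  | .case e₀ e₁ e₂, ρ => max (e₀.foldBound ρ) <|
      match e₀.den ρ with
      | .inl x => e₁.foldBound (x :: ρ)
      | .inr x => e₂.foldBound (x :: ρ)
      | _ => 0
  | .con _ e, ρ => e.foldBound ρ
  | .destr _ e, ρ => e.foldBound ρ
  | .fold P f e, ρ => max (e.foldBound ρ) <|
      max ((e.den ρ).preorder P .id).length
        ((e.den ρ).foldSup P (fun x => f.den (x :: ρ)) (fun x => f.foldBound (x :: ρ)) .id)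
  | .safeCon _ e, ρ => e.foldBound ρ
  | .safeDestr _ e, ρ => e.foldBound ρ
  | .toSafe e, ρ => e.foldBound ρ
  | .toNorm e, ρ => e.foldBound ρ

/-! ### Typing without ramification -/

/-- Typing rules without conditions on ramification and inhabitation, which extend the rules of
both calculi. -/
inductive ETyping : Ctx → Term → Ty → Prop
  | var {Γ : Ctx} {i : ℕ} {γ : Ground} (hi : Γ[i]? = some γ) : ETyping Γ (.var i) (.ground γ)
  | lam {Γ : Ctx} {e : Term} {γ₁ γ₀ : Ground}
      (he : ETyping (γ₁ :: Γ) e (.ground γ₀)) : ETyping Γ (.lam e) (.arrow γ₁ γ₀)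
  | app {Γ : Ctx} {e₀ e₁ : Term} {γ₁ γ₀ : Ground} (h₀ : ETyping Γ e₀ (.arrow γ₁ γ₀))
      (h₁ : ETyping Γ e₁ (.ground γ₁)) : ETyping Γ (.app e₀ e₁) (.ground γ₀)
  | unit {Γ : Ctx} : ETyping Γ .unit (.ground .unit)
  | pair {Γ : Ctx} {e₁ e₂ : Term} {γ₁ γ₂ : Ground} (h₁ : ETyping Γ e₁ (.ground γ₁))
      (h₂ : ETyping Γ e₂ (.ground γ₂)) : ETyping Γ (.pair e₁ e₂) (.ground (.prod γ₁ γ₂))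
  | fst {Γ : Ctx} {e : Term} {γ₁ γ₂ : Ground} (h : ETyping Γ e (.ground (.prod γ₁ γ₂))) :
      ETyping Γ (.fst e) (.ground γ₁)
  | snd {Γ : Ctx} {e : Term} {γ₁ γ₂ : Ground} (h : ETyping Γ e (.ground (.prod γ₁ γ₂))) :
      ETyping Γ (.snd e) (.ground γ₂)
  | inl {Γ : Ctx} {e : Term} {γ₁ γ₂ : Ground}
      (h : ETyping Γ e (.ground γ₁)) : ETyping Γ (.inl e) (.ground (.sum γ₁ γ₂))
  | inr {Γ : Ctx} {e : Term} {γ₁ γ₂ : Ground}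
      (h : ETyping Γ e (.ground γ₂)) : ETyping Γ (.inr e) (.ground (.sum γ₁ γ₂))
  | case {Γ : Ctx} {e₀ e₁ e₂ : Term} {γ₁ γ₂ γ : Ground}
      (h₀ : ETyping Γ e₀ (.ground (.sum γ₁ γ₂))) (h₁ : ETyping (γ₁ :: Γ) e₁ (.ground γ))
      (h₂ : ETyping (γ₂ :: Γ) e₂ (.ground γ)) : ETyping Γ (.case e₀ e₁ e₂) (.ground γ)
  | con {Γ : Ctx} {P : Poly} {e : Term}
      (h : ETyping Γ e (.ground (P.app (.mu P)))) : ETyping Γ (.con P e) (.ground (.mu P))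
  | destr {Γ : Ctx} {P : Poly} {e : Term} (h : ETyping Γ e (.ground (.mu P))) :
      ETyping Γ (.destr P e) (.ground (P.app (.mu P)))
  | fold {Γ : Ctx} {P : Poly} {e₀ e₁ : Term} {γ : Ground}
      (h₀ : ETyping Γ (.lam e₀) (.arrow (P.app γ) γ)) (h₁ : ETyping Γ e₁ (.ground (.mu P))) :
      ETyping Γ (.fold P (.lam e₀) e₁) (.ground γ)
  | safeCon {Γ : Ctx} {P : Poly} {e : Term}
      (h : ETyping Γ e (.ground (P.app (.mu P)).toSafe)) :
      ETyping Γ (.safeCon P e) (.ground (.safeMu P))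
  | safeDestr {Γ : Ctx} {P : Poly} {e : Term} (h : ETyping Γ e (.ground (.safeMu P))) :
      ETyping Γ (.safeDestr P e) (.ground (P.app (.mu P)).toSafe)
  | toSafe {Γ : Ctx} {e : Term} {γ : Ground} (h : ETyping Γ e (.ground γ)) :
      ETyping Γ (.toSafe e) (.ground γ.toSafe)
  | toNorm {Γ : Ctx} {e : Term} {γ : Ground} (h : ETyping Γ e (.ground γ)) :
      ETyping Γ (.toNorm e) (.ground γ.toNormal)

theorem STyping.toETyping {Γ : Ctx} {e : Term} {τ : Ty} (h : STyping Γ e τ) : ETyping Γ e τ := by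
  induction h <;> constructor <;> assumption

theorem RSTyping.toETyping {Γ : Ctx} {e : Term} {τ : Ty} (h : RSTyping Γ e τ) :
    ETyping Γ e τ := by
  induction h <;> constructor <;> assumption

/-- The context of the denotation of a term of the given type: function terms have an additional
variable. -/
def Ty.extend (Γ : Ctx) : Ty → Ctx
  | .ground _ => Γ
  | .arrow γ _ => γ :: Γ

/-- The result type. -/
def Ty.result : Ty → Ground
  | .ground γ => γ
  | .arrow _ γ => γ

/-- `ρ` is an environment for the context `Γ`. -/
abbrev EnvTy (ρ : List Tree) (Γ : Ctx) : Prop := List.Forall₂ Tree.HasTy ρ Γ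

theorem EnvTy.lookup {ρ : List Tree} {Γ : Ctx} (h : EnvTy ρ Γ) {i : ℕ} {γ : Ground}
    (hi : Γ[i]? = some γ) : ∃ t, ρ[i]? = some t ∧ t.HasTy γ := by
  induction h generalizing i with
  | nil => simp at hi
  | cons ht _ ih =>
    cases i with
    | zero => simp_all
    | succ i => simpa using ih (by simpa using hi)

theorem ETyping.hasTy_den {Γ : Ctx} {e : Term} {τ : Ty} (h : ETyping Γ e τ) :
    ∀ {ρ : List Tree}, EnvTy ρ (τ.extend Γ) → (e.den ρ).HasTy τ.result := by
  induction h with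
  | var hi =>
    intro ρ hρ
    obtain ⟨t, ht, hγ⟩ := EnvTy.lookup hρ hi
    simpa [Term.den, ht, Ty.result] using hγ
  | lam he ih => intro ρ hρ; exact ih hρ
  | app h₀ h₁ ih₀ ih₁ => intro ρ hρ; exact ih₀ (.cons (ih₁ hρ) hρ)
  | unit => intro ρ hρ; trivial
  | pair h₁ h₂ ih₁ ih₂ => intro ρ hρ; exact ⟨ih₁ hρ, ih₂ hρ⟩
  | fst h ih =>
    intro ρ hρ
    obtain ⟨u, v, he, hu, hv⟩ := Tree.hasTy_prod_iff.1 (ih hρ)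
    simpa [Term.den, he, Tree.fst, Ty.result] using hu
  | snd h ih =>
    intro ρ hρ
    obtain ⟨u, v, he, hu, hv⟩ := Tree.hasTy_prod_iff.1 (ih hρ)
    simpa [Term.den, he, Tree.snd, Ty.result] using hv
  | inl h ih => intro ρ hρ; exact ih hρ
  | inr h ih => intro ρ hρ; exact ih hρ
  | case h₀ h₁ h₂ ih₀ ih₁ ih₂ =>
    intro ρ hρ
    obtain ⟨u, he, hu⟩ | ⟨u, he, hu⟩ := Tree.hasTy_sum_iff.1 (ih₀ hρ)
    · simpa [Term.den, he, Tree.caseOf] using ih₁ (.cons hu hρ)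
    · simpa [Term.den, he, Tree.caseOf] using ih₂ (.cons hu hρ)
  | con h ih => intro ρ hρ; exact ⟨rfl, ih hρ⟩
  | destr h ih =>
    intro ρ hρ
    obtain ⟨u, he, hu⟩ := Tree.hasTy_mu_iff.1 (ih hρ)
    simpa [Term.den, he, Tree.destr, Ty.result] using hu
  | fold h₀ h₁ ih₀ ih₁ =>
    intro ρ hρ
    exact Tree.hasTy_mapFold (fun x hx => ih₀ (.cons hx hρ)) _ .id (ih₁ hρ)
  | safeCon h ih => intro ρ hρ; exact ⟨rfl, Tree.hasTy_toSafe.1 (ih hρ)⟩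
  | safeDestr h ih =>
    intro ρ hρ
    obtain ⟨u, he, hu⟩ := Tree.hasTy_safeMu_iff.1 (ih hρ)
    simpa [Term.den, he, Tree.destr, Ty.result] using hu
  | toSafe h ih => intro ρ hρ; exact Tree.hasTy_toSafe.2 (ih hρ)
  | toNorm h ih => intro ρ hρ; exact Tree.hasTy_toNormal.2 (ih hρ)

/-- Variables beyond the context do not occur in the term. Since index 0 is innermost, weakening at
the outer end requires no renaming, and a one-variable term can be reused unchanged under further
variables. -/
theorem ETyping.den_append {Γ : Ctx} {e : Term} {τ : Ty} (h : ETyping Γ e τ) (ρ' : List Tree) :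
    ∀ {ρ : List Tree}, ρ.length = (τ.extend Γ).length → e.den (ρ ++ ρ') = e.den ρ := by
  have cons {γ : Ground} {Δ : Ctx} {ρ : List Tree} (x : Tree) (h : ρ.length = Δ.length) :
      (x :: ρ).length = (γ :: Δ).length := by simpa using h
  induction h with
  | var hi =>
    intro ρ hρ
    obtain ⟨hi, -⟩ := List.getElem?_eq_some_iff.1 hi
    simp only [Term.den]
    rw [List.getElem?_append_left (by simpa [hρ, Ty.extend] using hi)]
  | lam he ih => intro ρ hρ; exact ih hρ
  | app h₀ h₁ ih₀ ih₁ =>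
    intro ρ hρ
    simp only [Term.den]
    rw [ih₁ hρ, ← List.cons_append, ih₀ (cons _ hρ)]
  | case h₀ h₁ h₂ ih₀ ih₁ ih₂ =>
    intro ρ hρ
    simp only [Term.den]
    rw [ih₀ hρ]
    congr 1 <;> funext x <;> rw [← List.cons_append]
    · rw [ih₁ (cons _ hρ)]
    · rw [ih₂ (cons _ hρ)]
  | fold h₀ h₁ ih₀ ih₁ =>
    intro ρ hρ
    simp only [Term.den] at ih₀ ⊢
    rw [ih₁ hρ]
    congr 1
    funext x
    rw [← List.cons_append, ih₀ (cons _ hρ)]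
  | _ =>
    intro ρ hρ
    simp only [Term.den]
    try simp_all [Ty.extend]

/-- Needed to weaken `toNorm`: appended variables may have safe types, but they are not free in the
term, so the side condition survives. -/
theorem ETyping.lt_length_of_freeIn {Γ : Ctx} {e : Term} {τ : Ty} (h : ETyping Γ e τ) {i : ℕ}
    (hi : e.FreeIn i) : i < Γ.length := by
  induction h generalizing i with
  | var h =>
    obtain ⟨h, -⟩ := List.getElem?_eq_some_iff.1 h
    simp only [Term.FreeIn] at hi
    omega
  | lam he ih => simpa using ih hi
  | app h₀ h₁ ih₀ ih₁ => exact hi.elim ih₀ ih₁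
  | unit => exact hi.elim
  | pair h₁ h₂ ih₁ ih₂ => exact hi.elim ih₁ ih₂
  | case h₀ h₁ h₂ ih₀ ih₁ ih₂ =>
    obtain hi | hi | hi := hi
    · exact ih₀ hi
    · simpa using ih₁ hi
    · simpa using ih₂ hi
  | fold h₀ h₁ ih₀ ih₁ => exact hi.elim ih₀ ih₁
  | _ h ih => exact ih hi

theorem getElem?_append_of_eq_some {α : Type*} {l : List α} {i : ℕ} {a : α} (h : l[i]? = some a)
    (l' : List α) : (l ++ l')[i]? = some a := by
  obtain ⟨hi, -⟩ := List.getElem?_eq_some_iff.1 h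
  rw [List.getElem?_append_left hi, h]

theorem STyping.append {Γ : Ctx} {e : Term} {τ : Ty} (h : STyping Γ e τ) (Δ : Ctx) :
    STyping (Γ ++ Δ) e τ := by
  induction h with
  | var hγ hi => exact .var hγ (getElem?_append_of_eq_some hi Δ)
  | _ => constructor <;> assumption

theorem RSTyping.append {Γ : Ctx} {e : Term} {τ : Ty} (h : RSTyping Γ e τ) (Δ : Ctx) :
    RSTyping (Γ ++ Δ) e τ := by
  induction h with
  | var hγ hi => exact .var hγ (getElem?_append_of_eq_some hi Δ)
  | toNorm hside h ih =>
    refine .toNorm (fun i γ' hi hγ' => hside i γ' hi ?_) ih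
    rwa [List.getElem?_append_left (h.toETyping.lt_length_of_freeIn hi)] at hγ'
  | _ => constructor <;> assumption

/-! ### Evaluation and denotations -/

/-- `TDPolyCost` bounds the cost of some derivation, and `ETyping.evaluatesAt` constructs a
derivation. Determinism identifies the two. -/
theorem Eval.unique {e : Term} {θ : List ℕ} {h : Heap} {v : ℕ} {k : Heap} {n : ℕ}
    (d : Eval e θ h v k n) : ∀ {v' : ℕ} {k' : Heap} {n' : ℕ}, Eval e θ h v' k' n' →
    v = v' ∧ k = k' ∧ n = n' := by
  induction d with
  | var hi =>
    intro v' k' n' d'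
    cases d' with
    | var hi' => simp_all
  | unit =>
    intro v' k' n' d'
    cases d'
    simp
  | app d₁ d₀ ih₁ ih₀ =>
    intro v' k' n' d'
    cases d' with
    | app d₁' d₀' =>
      obtain ⟨rfl, rfl, rfl⟩ := ih₁ d₁'
      obtain ⟨rfl, rfl, rfl⟩ := ih₀ d₀'
      simp
  | pair d₁ d₀ ih₁ ih₀ =>
    intro v' k' n' d'
    cases d' with
    | pair d₁' d₀' =>
      obtain ⟨rfl, rfl, rfl⟩ := ih₁ d₁'
      obtain ⟨rfl, rfl, rfl⟩ := ih₀ d₀'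
      simp
  | caseInl d₀ hv d ih₀ ih =>
    intro v' k' n' d'
    cases d' with
    | caseInl d₀' hv' d' =>
      obtain ⟨rfl, rfl, rfl⟩ := ih₀ d₀'
      obtain rfl : _ = _ := by simpa [hv] using hv'
      obtain ⟨rfl, rfl, rfl⟩ := ih d'
      simp
    | caseInr d₀' hv' d' =>
      obtain ⟨rfl, rfl, rfl⟩ := ih₀ d₀'
      simp [hv] at hv'
  | caseInr d₀ hv d ih₀ ih =>
    intro v' k' n' d'
    cases d' with
    | caseInr d₀' hv' d' =>
      obtain ⟨rfl, rfl, rfl⟩ := ih₀ d₀'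
      obtain rfl : _ = _ := by simpa [hv] using hv'
      obtain ⟨rfl, rfl, rfl⟩ := ih d'
      simp
    | caseInl d₀' hv' d' =>
      obtain ⟨rfl, rfl, rfl⟩ := ih₀ d₀'
      simp [hv] at hv'
  | fst d hv ih | snd d hv ih | destr d hv ih | safeDestr d hv ih =>
    intro v' k' n' d'
    cases d'
    rename_i d' hv'
    obtain ⟨rfl, rfl, rfl⟩ := ih d'
    rw [hv] at hv'
    cases hv'
    simp
  | inl d ih | inr d ih | con d ih | safeCon d ih | toSafe d ih | toNorm d ih | fold d ih =>
    intro v' k' n' d'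
    cases d'
    rename_i d'
    obtain ⟨rfl, rfl, rfl⟩ := ih d'
    simp

/-! ### Term graphs and their unfoldings. -/

/-- `Rep h a t`: the part of `h` rooted at the vertex `a` unfolds to the tree `t`. -/
def Rep (h : Heap) : ℕ → Tree → Prop
  | a, .unit => h[a]? = some .unit
  | a, .inl t => ∃ b, h[a]? = some (.inl b) ∧ Rep h b t
  | a, .inr t => ∃ b, h[a]? = some (.inr b) ∧ Rep h b t
  | a, .pair t u => ∃ b c, h[a]? = some (.pair b c) ∧ Rep h b t ∧ Rep h c u
  | a, .con P t => ∃ b, h[a]? = some (.con P b) ∧ Rep h b t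

theorem Rep.append {h : Heap} {a : ℕ} {t : Tree} (ht : Rep h a t) (h' : Heap) :
    Rep (h ++ h') a t := by
  induction t generalizing a with
  | unit => exact getElem?_append_of_eq_some ht h'
  | inl t ih | inr t ih | con P t ih =>
    obtain ⟨b, hb, hr⟩ := ht
    exact ⟨b, getElem?_append_of_eq_some hb h', ih hr⟩
  | pair t u iht ihu =>
    obtain ⟨b, c, hb, hr, hr'⟩ := ht
    exact ⟨b, c, getElem?_append_of_eq_some hb h', iht hr, ihu hr'⟩

theorem Rep.mono {h h' : Heap} {a : ℕ} {t : Tree} (ht : Rep h a t) (hh : h <+: h') :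
    Rep h' a t := by
  obtain ⟨l, rfl⟩ := hh
  exact ht.append l

theorem IsValue.exists_rep {h : Heap} {γ : Ground} {a : ℕ} (ha : IsValue h γ a) :
    ∃ t, Rep h a t ∧ t.HasTy γ := by
  induction ha with
  | unit ha => exact ⟨.unit, ha, trivial⟩
  | inl ha _ ih => obtain ⟨t, hr, ht⟩ := ih; exact ⟨.inl t, ⟨_, ha, hr⟩, ht⟩
  | inr ha _ ih => obtain ⟨t, hr, ht⟩ := ih; exact ⟨.inr t, ⟨_, ha, hr⟩, ht⟩
  | pair ha _ _ ih ih' =>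
    obtain ⟨t, hr, ht⟩ := ih
    obtain ⟨u, hr', hu⟩ := ih'
    exact ⟨.pair t u, ⟨_, _, ha, hr, hr'⟩, ht, hu⟩
  | con ha _ ih => obtain ⟨t, hr, ht⟩ := ih; exact ⟨.con _ t, ⟨_, ha, hr⟩, rfl, ht⟩

theorem Poly.isNormal_app {γ : Ground} (hγ : γ.IsNormal) (P : Poly) : (P.app γ).IsNormal := by
  induction P <;> simp_all [Poly.app, Ground.IsNormal]

/-- Both vertices are read along the common unfolding. Normality excludes the safe types, for which
`Bisim` has no rule. -/
theorem Rep.bisim {h h' : Heap} {t : Tree} : ∀ {a a' : ℕ} {γ : Ground}, Rep h a t → Rep h' a' t →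
    t.HasTy γ → γ.IsNormal → Bisim h h' γ a a' := by
  induction t with
  | unit =>
    intro a a' γ hr hr' ht hγ
    cases γ <;> simp only [Tree.HasTy, Ground.IsNormal] at ht hγ
    exact .unit hr hr'
  | inl t ih =>
    rintro a a' γ ⟨b, hb, hr⟩ ⟨b', hb', hr'⟩ ht hγ
    cases γ <;> simp only [Tree.HasTy, Ground.IsNormal] at ht hγ
    exact .inl hb hb' (ih hr hr' ht hγ.1)
  | inr t ih =>
    rintro a a' γ ⟨b, hb, hr⟩ ⟨b', hb', hr'⟩ ht hγ
    cases γ <;> simp only [Tree.HasTy, Ground.IsNormal] at ht hγ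
    exact .inr hb hb' (ih hr hr' ht hγ.2)
  | pair t u iht ihu =>
    rintro a a' γ ⟨b, c, hb, hr, hs⟩ ⟨b', c', hb', hr', hs'⟩ ht hγ
    cases γ <;> simp only [Tree.HasTy, Ground.IsNormal] at ht hγ
    exact .pair hb hb' (iht hr hr' ht.1 hγ.1) (ihu hs hs' ht.2 hγ.2)
  | con P t ih =>
    rintro a a' γ ⟨b, hb, hr⟩ ⟨b', hb', hr'⟩ ht hγ
    cases γ <;> simp only [Tree.HasTy, Ground.IsNormal] at ht hγ
    obtain ⟨rfl, ht⟩ := ht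
    exact .con hb hb' (ih hr hr' ht (Poly.isNormal_app (γ := .mu P) trivial P))

theorem Heap.Edge.target {h : Heap} {a b : ℕ} (hab : h.Edge a b) :
    h[a]? = some (.inl b) ∨ h[a]? = some (.inr b) ∨ (∃ c, h[a]? = some (.pair b c)) ∨
      (∃ c, h[a]? = some (.pair c b)) ∨ ∃ P, h[a]? = some (.con P b) := by
  cases hab with
  | inl h => exact .inl h
  | inr h => exact .inr (.inl h)
  | fst h => exact .inr (.inr (.inl ⟨_, h⟩))
  | snd h => exact .inr (.inr (.inr (.inl ⟨_, h⟩)))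
  | con h => exact .inr (.inr (.inr (.inr ⟨_, h⟩)))

/-- Each reachable constructor vertex appears at least once in the unfolding; sharing can only make
the graph smaller. With `encard` the union bounds need no finiteness, and finiteness itself follows
from the estimate. -/
theorem Rep.encard_le {h : Heap} {t : Tree} : ∀ {a : ℕ}, Rep h a t →
    {b : ℕ | Relation.ReflTransGen h.Edge a b ∧
      ∃ (P : Poly) (c : ℕ), h[b]? = some (.con P c)}.encard ≤ t.conCount := by
  have step (a : ℕ) : {b : ℕ | Relation.ReflTransGen h.Edge a b ∧
      ∃ (P : Poly) (c : ℕ), h[b]? = some (.con P c)} =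
      {b | b = a ∧ ∃ (P : Poly) (c : ℕ), h[b]? = some (.con P c)} ∪
      {b | ∃ c, h.Edge a c ∧ Relation.ReflTransGen h.Edge c b ∧
        ∃ (P : Poly) (c : ℕ), h[b]? = some (.con P c)} := by
    ext b
    simp only [Set.mem_ofPred_eq, Set.mem_union]
    rw [Relation.ReflTransGen.cases_head_iff]
    grind
  induction t with
  | unit =>
    intro a hr
    have hr : h[a]? = some .unit := hr
    refine le_of_eq (Set.encard_eq_zero.2 (Set.eq_empty_of_forall_notMem fun x hx => ?_))
    rw [step] at hx
    obtain ⟨rfl, P, c, hx⟩ | ⟨c, hc, hx⟩ := hx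
    · simp [hr] at hx
    · have := hc.target
      simp [hr] at this
  | inl t ih | inr t ih =>
    rintro a ⟨b, hb, hr⟩
    refine le_trans (Set.encard_le_encard ?_) (ih hr)
    rw [step]
    rintro x (⟨rfl, P, c, hx⟩ | ⟨c, hc, hx⟩)
    · simp [hb] at hx
    · have := hc.target
      simp only [hb] at this
      simp at this
      subst this
      exact hx
  | pair t u iht ihu =>
    rintro a ⟨b, c, hb, hr, hr'⟩
    have := add_le_add (iht hr) (ihu hr')
    refine le_trans (le_trans (Set.encard_le_encard ?_) (Set.encard_union_le _ _)) (by exact_mod_cast this)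
    rw [step]
    rintro x (⟨rfl, P, c, hx⟩ | ⟨c, hc, hx⟩)
    · simp [hb] at hx
    · have := hc.target
      simp only [hb] at this
      simp at this
      obtain rfl | rfl := this
      · exact .inl hx
      · exact .inr hx
  | con P t ih =>
    rintro a ⟨b, hb, hr⟩
    have := add_le_add (ih hr) (Set.encard_singleton a).le
    refine le_trans (le_trans (Set.encard_le_encard ?_) (Set.encard_union_le _ _)) (by exact_mod_cast this)
    rw [step]
    rintro x (⟨rfl, P, c, hx⟩ | ⟨c, hc, hx⟩)
    · exact .inr rfl
    · have := hc.target
      simp only [hb] at this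
      simp at this
      subst this
      exact .inl hx

theorem Rep.size_le {h : Heap} {a : ℕ} {t : Tree} (hr : Rep h a t) : h.size a ≤ t.conCount :=
  (Set.encard_le_coe_iff_finite_ncard_le.1 hr.encard_le).2

/-! ### Existence, value and cost of evaluations. -/

theorem Term.rename_rename (e : Term) : ∀ ρ ρ' : ℕ → ℕ,
    (e.rename ρ).rename ρ' = e.rename (ρ' ∘ ρ) := by
  have lift (ρ ρ' : ℕ → ℕ) : liftRen ρ' ∘ liftRen ρ = liftRen (ρ' ∘ ρ) := by
    funext i; cases i <;> rfl
  induction e <;> simp_all [Term.rename, Function.comp_def]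

/-- The vertices `θ`, read along the renaming `r`, are the values `ρ`. -/
def EnvRep (h : Heap) (θ : List ℕ) (r : ℕ → ℕ) (ρ : List Tree) : Prop :=
  ∀ i t, ρ[i]? = some t → ∃ v, θ[r i]? = some v ∧ Rep h v t

theorem EnvRep.mono {h h' : Heap} {θ : List ℕ} {r : ℕ → ℕ} {ρ : List Tree}
    (hθ : EnvRep h θ r ρ) (hh : h <+: h') : EnvRep h' θ r ρ := by
  intro i t hi
  obtain ⟨v, hv, hr⟩ := hθ i t hi
  exact ⟨v, hv, hr.mono hh⟩

theorem EnvRep.cons {h : Heap} {θ : List ℕ} {r : ℕ → ℕ} {ρ : List Tree} {v : ℕ} {x : Tree}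
    (hθ : EnvRep h θ r ρ) (hv : Rep h v x) : EnvRep h (v :: θ) (liftRen r) (x :: ρ) := by
  intro i t hi
  cases i with
  | zero =>
    obtain rfl : x = t := by simpa using hi
    exact ⟨v, rfl, hv⟩
  | succ i => simpa [liftRen] using hθ i t (by simpa using hi)

theorem EnvRep.weaken {h : Heap} {θ : List ℕ} {r : ℕ → ℕ} {ρ : List Tree}
    (hθ : EnvRep h θ r ρ) (v : ℕ) : EnvRep h (v :: θ) (Nat.succ ∘ r) ρ := by
  intro i t hi
  simpa using hθ i t hi

/-- In any environment for the context `Γ`, and under any renaming, the evaluation of `e` yields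
its denotation, at a cost no smaller than the lengths of the recursions. -/
def Evaluates (Γ : Ctx) (e : Term) : Prop :=
  ∀ (r : ℕ → ℕ) (θ : List ℕ) (h : Heap) (ρ : List Tree), EnvTy ρ Γ → EnvRep h θ r ρ →
    ∃ v k n, Eval (e.rename r) θ h v k n ∧ h <+: k ∧ Rep k v (e.den ρ) ∧ e.foldBound ρ ≤ n

/-- The functorial action places copies of the step function under the binders that products and
sums introduce. These copies are shifted and evaluated in longer environments, so the claim must
hold for all renamings `r` and environments `θ`. The term `s` is the argument of the action, still
unevaluated, with cost `n`. -/
theorem Evaluates.mapFold {Γ : Ctx} {P : Poly} {γ : Ground} {e : Term} {ρ : List Tree}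
    (he : Evaluates (P.app γ :: Γ) e) (hρ : EnvTy ρ Γ)
    (hty : ∀ x, x.HasTy (P.app γ) → (e.den (x :: ρ)).HasTy γ) (t : Tree) :
    ∀ (Q : Poly) (r : ℕ → ℕ) (θ : List ℕ) (h h₁ : Heap) (s : Term) (v n : ℕ),
    t.HasTy (Q.app (.mu P)) → EnvRep h θ r ρ → Eval s θ h v h₁ n → h <+: h₁ → Rep h₁ v t →
    ∃ w k m, Eval (Poly.mapFold P Q ((Term.lam e).rename r) s) θ h w k m ∧ h₁ <+: k ∧
      Rep k w (t.mapFold P (fun x => e.den (x :: ρ)) Q) ∧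
      n + (t.preorder P Q).length ≤ m ∧
      t.foldSup P (fun x => e.den (x :: ρ)) (fun x => e.foldBound (x :: ρ)) Q ≤ m := by
  have const (Q : Poly) (f s : Term) (t : Tree) (θ : List ℕ) (h h₁ : Heap) (v n : ℕ)
      (hQ : Poly.mapFold P Q f s = .app (.lam (.var 0)) s)
      (hm : t.mapFold P (fun x => e.den (x :: ρ)) Q = t)
      (hp : t.preorder P Q = [])
      (hb : t.foldSup P (fun x => e.den (x :: ρ)) (fun x => e.foldBound (x :: ρ)) Q = 0)
      (hd : Eval s θ h v h₁ n) (hr : Rep h₁ v t) :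
      ∃ w k m, Eval (Poly.mapFold P Q f s) θ h w k m ∧ h₁ <+: k ∧
        Rep k w (t.mapFold P (fun x => e.den (x :: ρ)) Q) ∧
        n + (t.preorder P Q).length ≤ m ∧
        t.foldSup P (fun x => e.den (x :: ρ)) (fun x => e.foldBound (x :: ρ)) Q ≤ m := by
    refine ⟨v, h₁, n + 1 + 1, ?_, List.prefix_rfl, ?_, ?_, ?_⟩
    · rw [hQ]; exact .app hd (.var rfl)
    · rwa [hm]
    · simp [hp]; omega
    · simp [hb]
  have shift (f : Term) (r : ℕ → ℕ) : (f.rename r).shift = f.rename (Nat.succ ∘ r) :=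
    f.rename_rename r _
  induction t with
  | unit =>
    intro Q r θ h h₁ s v n ht hθ hd hh hr
    cases Q <;> simp only [Poly.app, Tree.HasTy] at ht
    exact const _ _ _ _ _ _ _ _ _ rfl rfl rfl rfl hd hr
  | con c t ih =>
    intro Q r θ h h₁ s v n ht hθ hd hh hr
    cases Q <;> simp only [Poly.app, Tree.HasTy] at ht
    case constMu R => exact const _ _ _ _ _ _ _ _ _ rfl rfl rfl rfl hd hr
    case id =>
      obtain ⟨rfl, ht⟩ := ht
      obtain ⟨b, hb, hr⟩ := hr
      -- The new argument is `destr P s`, of cost `n + 1`. The extra node pays for the entry that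
      -- this constructor adds to the preorder list.
      obtain ⟨w, k, m, hd', hk, hw, hm, hs⟩ := ih c r θ h h₁ _ b _ ht hθ (.destr hd hb) hh hr
      obtain ⟨v', k', m', hd'', hk', hw', hm'⟩ := he (liftRen r) (w :: θ) k _
        (.cons (Tree.hasTy_mapFold hty t c ht) hρ) ((hθ.mono (hh.trans hk)).cons hw)
      refine ⟨v', k', m + m' + 1 + 1, .fold (.app hd' hd''), hk.trans hk', hw', ?_, ?_⟩
      · simp only [Tree.preorder, List.length_cons]; omega
      · simp only [Tree.foldSup]; omega
  | inl t ih =>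
    intro Q r θ h h₁ s v n ht hθ hd hh hr
    cases Q <;> simp only [Poly.app, Tree.HasTy] at ht
    obtain ⟨b, hb, hr⟩ := hr
    obtain ⟨w, k, m, hd', hk, hw, hm, hs⟩ := ih _ (Nat.succ ∘ Nat.succ ∘ r) (b :: v :: θ) h₁ h₁
      (.var 0) b 1 ht (((hθ.mono hh).weaken v).weaken b) (.var rfl) List.prefix_rfl hr
    refine ⟨_, _, _, .app hd (.caseInl (.var rfl) hb (.inl (n := m) (v := w) (h₁ := k) ?_)), ?_⟩
    · simpa only [shift] using hd'
    · refine ⟨hk.trans (List.prefix_append _ _), ⟨w, by simp, hw.append _⟩, ?_, ?_⟩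
      · simp only [Tree.preorder]; omega
      · simp only [Tree.foldSup]; omega
  | inr t ih =>
    intro Q r θ h h₁ s v n ht hθ hd hh hr
    cases Q <;> simp only [Poly.app, Tree.HasTy] at ht
    obtain ⟨b, hb, hr⟩ := hr
    obtain ⟨w, k, m, hd', hk, hw, hm, hs⟩ := ih _ (Nat.succ ∘ Nat.succ ∘ r) (b :: v :: θ) h₁ h₁
      (.var 0) b 1 ht (((hθ.mono hh).weaken v).weaken b) (.var rfl) List.prefix_rfl hr
    refine ⟨_, _, _, .app hd (.caseInr (.var rfl) hb (.inr (n := m) (v := w) (h₁ := k) ?_)), ?_⟩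
    · simpa only [shift] using hd'
    · refine ⟨hk.trans (List.prefix_append _ _), ⟨w, by simp, hw.append _⟩, ?_, ?_⟩
      · simp only [Tree.preorder]; omega
      · simp only [Tree.foldSup]; omega
  | pair t u iht ihu =>
    intro Q r θ h h₁ s v n ht hθ hd hh hr
    cases Q <;> simp only [Poly.app, Tree.HasTy] at ht
    obtain ⟨b, c, hb, hr, hr'⟩ := hr
    obtain ⟨w, k, m, hd', hk, hw, hm, hs⟩ := iht _ (Nat.succ ∘ r) (v :: θ) h₁ h₁
      (.fst (.var 0)) b _ ht.1 ((hθ.mono hh).weaken v) (.fst (.var rfl) hb) List.prefix_rfl hr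
    have hb' : k[v]? = some (.pair b c) := by
      obtain ⟨l, rfl⟩ := hk
      exact getElem?_append_of_eq_some hb l
    obtain ⟨w', k', m', hd'', hk', hw', hm', hs'⟩ := ihu _ (Nat.succ ∘ r) (v :: θ) k k
      (.snd (.var 0)) c _ ht.2 ((hθ.mono (hh.trans hk)).weaken v) (.snd (.var rfl) hb')
      List.prefix_rfl (hr'.mono hk)
    refine ⟨_, _, _, .app hd (.pair (n₁ := m) (n₂ := m') (v₁ := w) (v₂ := w') (h₁ := k) (h₂ := k')
      ?_ ?_), ?_⟩
    · simpa only [shift] using hd'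
    · simpa only [shift] using hd''
    · refine ⟨(hk.trans hk').trans (List.prefix_append _ _),
        ⟨w, w', by simp, (hw.mono hk').append _, hw'.append _⟩, ?_, ?_⟩
      · simp only [Tree.preorder, List.length_append]; omega
      · simp only [Tree.foldSup]; omega

/-- `Evaluates` for terms of ground type and for the bodies of function terms. -/
def EvaluatesAt (Γ : Ctx) (e : Term) : Ty → Prop
  | .ground _ => Evaluates Γ e
  | .arrow γ _ => ∃ b, e = .lam b ∧ Evaluates (γ :: Γ) b

/-- Totality, correctness and the lower bound on the cost come from one induction. The rules of
`ETyping` cover both calculi, so this applies to the given term and to its ramified translation. -/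
theorem ETyping.evaluatesAt {Γ : Ctx} {e : Term} {τ : Ty} (he : ETyping Γ e τ) :
    EvaluatesAt Γ e τ := by
  induction he with
  | var hi =>
    intro r θ h ρ hρ hθ
    obtain ⟨t, ht, -⟩ := EnvTy.lookup hρ hi
    obtain ⟨v, hv, hr⟩ := hθ _ _ ht
    exact ⟨v, h, 1, .var hv, List.prefix_rfl, by simpa [Term.den, ht] using hr, Nat.zero_le _⟩
  | lam he ih => exact ⟨_, rfl, ih⟩
  | app h₀ h₁ ih₀ ih₁ =>
    intro r θ h ρ hρ hθ
    obtain ⟨b, rfl, ih₀⟩ := ih₀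
    obtain ⟨v, k, n, hd, hk, hv, hn⟩ := ih₁ r θ h ρ hρ hθ
    obtain ⟨v', k', n', hd', hk', hv', hn'⟩ := ih₀ (liftRen r) (v :: θ) k _
      (.cons (h₁.hasTy_den hρ) hρ) ((hθ.mono hk).cons hv)
    refine ⟨v', k', n + n' + 1, .app hd hd', hk.trans hk', hv', ?_⟩
    simp only [Term.foldBound]; omega
  | unit =>
    intro r θ h ρ hρ hθ
    exact ⟨_, _, _, .unit, List.prefix_append _ _, by simp [Rep, Term.den], Nat.zero_le _⟩
  | pair h₁ h₂ ih₁ ih₂ =>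
    intro r θ h ρ hρ hθ
    obtain ⟨v, k, n, hd, hk, hv, hn⟩ := ih₁ r θ h ρ hρ hθ
    obtain ⟨v', k', n', hd', hk', hv', hn'⟩ := ih₂ r θ k ρ hρ (hθ.mono hk)
    refine ⟨_, _, _, .pair hd hd', (hk.trans hk').trans (List.prefix_append _ _),
      ⟨v, v', by simp, (hv.mono hk').append _, hv'.append _⟩, ?_⟩
    simp only [Term.foldBound]; omega
  | fst h ih =>
    intro r θ h ρ hρ hθ
    obtain ⟨v, k, n, hd, hk, hv, hn⟩ := ih r θ h ρ hρ hθ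
    obtain ⟨t, u, he, -⟩ := Tree.hasTy_prod_iff.1 (ETyping.hasTy_den ‹_› hρ)
    rw [he] at hv
    obtain ⟨b, c, hb, hr, -⟩ := hv
    refine ⟨_, _, _, .fst hd hb, hk, by simpa [Term.den, he, Tree.fst] using hr, ?_⟩
    simp only [Term.foldBound]; omega
  | snd h ih =>
    intro r θ h ρ hρ hθ
    obtain ⟨v, k, n, hd, hk, hv, hn⟩ := ih r θ h ρ hρ hθ
    obtain ⟨t, u, he, -⟩ := Tree.hasTy_prod_iff.1 (ETyping.hasTy_den ‹_› hρ)
    rw [he] at hv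
    obtain ⟨b, c, hb, -, hr⟩ := hv
    refine ⟨_, _, _, .snd hd hb, hk, by simpa [Term.den, he, Tree.snd] using hr, ?_⟩
    simp only [Term.foldBound]; omega
  | inl h ih =>
    intro r θ h ρ hρ hθ
    obtain ⟨v, k, n, hd, hk, hv, hn⟩ := ih r θ h ρ hρ hθ
    refine ⟨_, _, _, .inl hd, hk.trans (List.prefix_append _ _), ⟨v, by simp, hv.append _⟩, ?_⟩
    simp only [Term.foldBound]; omega
  | inr h ih =>
    intro r θ h ρ hρ hθ
    obtain ⟨v, k, n, hd, hk, hv, hn⟩ := ih r θ h ρ hρ hθ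
    refine ⟨_, _, _, .inr hd, hk.trans (List.prefix_append _ _), ⟨v, by simp, hv.append _⟩, ?_⟩
    simp only [Term.foldBound]; omega
  | case h₀ h₁ h₂ ih₀ ih₁ ih₂ =>
    intro r θ h ρ hρ hθ
    obtain ⟨v, k, n, hd, hk, hv, hn⟩ := ih₀ r θ h ρ hρ hθ
    obtain ⟨u, he, hu⟩ | ⟨u, he, hu⟩ := Tree.hasTy_sum_iff.1 (h₀.hasTy_den hρ)
    · rw [he] at hv
      obtain ⟨b, hb, hr⟩ := hv
      obtain ⟨v', k', n', hd', hk', hv', hn'⟩ := ih₁ (liftRen r) (b :: θ) k _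
        (.cons hu hρ) ((hθ.mono hk).cons hr)
      refine ⟨_, _, _, .caseInl hd hb hd', hk.trans hk', ?_, ?_⟩
      · simpa [Term.den, he, Tree.caseOf] using hv'
      · simp only [Term.foldBound, he]; omega
    · rw [he] at hv
      obtain ⟨b, hb, hr⟩ := hv
      obtain ⟨v', k', n', hd', hk', hv', hn'⟩ := ih₂ (liftRen r) (b :: θ) k _
        (.cons hu hρ) ((hθ.mono hk).cons hr)
      refine ⟨_, _, _, .caseInr hd hb hd', hk.trans hk', ?_, ?_⟩
      · simpa [Term.den, he, Tree.caseOf] using hv'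
      · simp only [Term.foldBound, he]; omega
  | con h ih =>
    intro r θ h ρ hρ hθ
    obtain ⟨v, k, n, hd, hk, hv, hn⟩ := ih r θ h ρ hρ hθ
    refine ⟨_, _, _, .con hd, hk.trans (List.prefix_append _ _), ⟨v, by simp, hv.append _⟩, ?_⟩
    simp only [Term.foldBound]; omega
  | destr h ih =>
    intro r θ h ρ hρ hθ
    obtain ⟨v, k, n, hd, hk, hv, hn⟩ := ih r θ h ρ hρ hθ
    obtain ⟨u, he, -⟩ := Tree.hasTy_mu_iff.1 (ETyping.hasTy_den ‹_› hρ)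
    rw [he] at hv
    obtain ⟨b, hb, hr⟩ := hv
    refine ⟨_, _, _, .destr hd hb, hk, by simpa [Term.den, he, Tree.destr] using hr, ?_⟩
    simp only [Term.foldBound]; omega
  | @fold Γ P e₀ e₁ γ h₀ h₁ ih₀ ih₁ =>
    intro r θ h ρ hρ hθ
    obtain ⟨b, hb, ih₀⟩ := ih₀
    obtain rfl : e₀ = b := by simpa using hb
    obtain ⟨v, k, n, hd, hk, hv, hn⟩ := ih₁ r θ h ρ hρ hθ
    obtain ⟨w, k', m, hd', hk', hw, hm, hs⟩ := ih₀.mapFold hρ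
      (fun x hx => h₀.hasTy_den (.cons hx hρ)) _ .id r θ h k _ v n (h₁.hasTy_den hρ) hθ hd hk hv
    refine ⟨w, k', m, hd', hk.trans hk', hw, ?_⟩
    simp only [Term.foldBound, max_le_iff]
    exact ⟨by omega, by omega, hs⟩
  | safeCon h ih =>
    intro r θ h ρ hρ hθ
    obtain ⟨v, k, n, hd, hk, hv, hn⟩ := ih r θ h ρ hρ hθ
    refine ⟨_, _, _, .safeCon hd, hk.trans (List.prefix_append _ _),
      ⟨v, by simp, hv.append _⟩, ?_⟩
    simp only [Term.foldBound]; omega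
  | safeDestr h ih =>
    intro r θ h ρ hρ hθ
    obtain ⟨v, k, n, hd, hk, hv, hn⟩ := ih r θ h ρ hρ hθ
    obtain ⟨u, he, -⟩ := Tree.hasTy_safeMu_iff.1 (ETyping.hasTy_den ‹_› hρ)
    rw [he] at hv
    obtain ⟨b, hb, hr⟩ := hv
    refine ⟨_, _, _, .safeDestr hd hb, hk, by simpa [Term.den, he, Tree.destr] using hr, ?_⟩
    simp only [Term.foldBound]; omega
  | toSafe h ih =>
    intro r θ h ρ hρ hθ
    obtain ⟨v, k, n, hd, hk, hv, hn⟩ := ih r θ h ρ hρ hθ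
    exact ⟨_, _, _, .toSafe hd, hk, hv, Nat.le_succ_of_le hn⟩
  | toNorm h ih =>
    intro r θ h ρ hρ hθ
    obtain ⟨v, k, n, hd, hk, hv, hn⟩ := ih r θ h ρ hρ hθ
    exact ⟨_, _, _, .toNorm hd, hk, hv, Nat.le_succ_of_le hn⟩

/-! ### Admissible types -/

@[simp] theorem Ground.admissible_toSafe {γ : Ground} : γ.toSafe.Admissible ↔ γ.Admissible := by
  induction γ <;> simp_all [Ground.toSafe, Ground.Admissible]

@[simp] theorem Ground.admissible_toNormal {γ : Ground} :
    γ.toNormal.Admissible ↔ γ.Admissible := by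
  induction γ <;> simp_all [Ground.toNormal, Ground.Admissible]

theorem Ground.isSafe_toSafe (γ : Ground) : γ.toSafe.IsSafe := by
  induction γ <;> simp_all [Ground.toSafe, Ground.IsSafe]

theorem Ground.IsSafe.toSafe_eq {γ : Ground} (h : γ.IsSafe) : γ.toSafe = γ := by
  induction γ <;> simp_all [Ground.toSafe, Ground.IsSafe]

theorem Ground.toNormal_toSafe {γ : Ground} (h : γ.IsNormal) : γ.toSafe.toNormal = γ := by
  induction γ <;> simp_all [Ground.toNormal, Ground.toSafe, Ground.IsNormal]

theorem Poly.ConstsInhabited.admissible_app {P : Poly} (hP : P.ConstsInhabited) {γ : Ground}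
    (hγ : γ.Admissible) : (P.app γ).Admissible := by
  induction P <;> simp_all [Poly.app, Ground.Admissible, Poly.ConstsInhabited]

theorem Ground.admissible_app_mu {P : Poly} (h : (Ground.mu P).Admissible) :
    (P.app (.mu P)).Admissible :=
  h.2.admissible_app h

/-- All ground types in a type are admissible. -/
def Ty.Admissible : Ty → Prop
  | .ground γ => γ.Admissible
  | .arrow γ₁ γ₀ => γ₁.Admissible ∧ γ₀.Admissible

theorem RSTyping.admissible {Γ : Ctx} {e : Term} {τ : Ty} (h : RSTyping Γ e τ) :
    τ.Admissible := by
  induction h with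
  | destr h ih => exact Ground.admissible_app_mu ih
  | safeDestr h ih => exact Ground.admissible_toSafe.2 (Ground.admissible_app_mu ih)
  | _ => simp_all [Ty.Admissible, Ground.Admissible]

/-- All ground types in a type are ground types of the unramified calculus. -/
def Ty.IsSType : Ty → Prop
  | .ground γ => γ.IsSType
  | .arrow γ₁ γ₀ => γ₁.IsSType ∧ γ₀.IsSType

theorem STyping.isSType {Γ : Ctx} {e : Term} {τ : Ty} (h : STyping Γ e τ) : τ.IsSType := by
  induction h with
  | var hγ hi => exact hγ
  | lam hγ he ih => exact ⟨hγ, ih⟩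
  | app h₀ h₁ ih₀ ih₁ => exact ih₀.2
  | unit => exact ⟨trivial, trivial⟩
  | pair h₁ h₂ ih₁ ih₂ => exact ⟨⟨ih₁.1, ih₂.1⟩, ih₁.2, ih₂.2⟩
  | fst h ih => exact ⟨ih.1.1, ih.2.1⟩
  | snd h ih => exact ⟨ih.1.2, ih.2.2⟩
  | inl hγ h ih => exact ⟨⟨ih.1, hγ.1⟩, ih.2, hγ.2⟩
  | inr hγ h ih => exact ⟨⟨hγ.1, ih.1⟩, hγ.2, ih.2⟩
  | case h₀ h₁ h₂ ih₀ ih₁ ih₂ => exact ih₁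
  | con hP h ih => exact hP
  | destr h ih => exact ⟨Poly.isNormal_app (γ := .mu _) trivial _, Ground.admissible_app_mu ih.2⟩
  | fold h₀ h₁ ih₀ ih₁ => exact ih₀.2

/-! ### Functions definable in the ramified calculus -/

/-- `F` is defined by a term of the ramified calculus of type `δ` with one variable, of
type `γ`. -/
def RSFun (γ δ : Ground) (F : Tree → Tree) : Prop :=
  ∃ e, RSTyping [γ] e (.ground δ) ∧ ∀ t, t.HasTy γ → e.den [t] = F t

namespace RSFun

variable {γ δ ε σ γ₁ γ₂ : Ground} {P : Poly} {F G H : Tree → Tree}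

theorem congr (hF : RSFun γ δ F) (h : ∀ t, t.HasTy γ → F t = G t) : RSFun γ δ G := by
  obtain ⟨e, he, hd⟩ := hF
  exact ⟨e, he, fun t ht => (hd t ht).trans (h t ht)⟩

theorem admissible (hF : RSFun γ δ F) : δ.Admissible := by
  obtain ⟨e, he, -⟩ := hF
  exact he.admissible

theorem hasTy (hF : RSFun γ δ F) {t : Tree} (ht : t.HasTy γ) : (F t).HasTy δ := by
  obtain ⟨e, he, hd⟩ := hF
  rw [← hd t ht]
  exact he.toETyping.hasTy_den (.cons ht .nil)

theorem id (hγ : γ.Admissible) : RSFun γ γ (fun t => t) :=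
  ⟨.var 0, .var hγ rfl, fun _ _ => rfl⟩

/-- Composition is a β-redex, which avoids substitution into terms: the term for `G` is only
weakened by an unused outer variable. -/
theorem comp (hG : RSFun δ ε G) (hF : RSFun γ δ F) : RSFun γ ε (fun t => G (F t)) := by
  have hδ := hF.admissible
  have hty := fun t => hF.hasTy (t := t)
  obtain ⟨e, he, hd⟩ := hG
  obtain ⟨e', he', hd'⟩ := hF
  refine ⟨.app (.lam e) e', .app (.lam hδ (he.append [γ])) he', fun t ht => ?_⟩
  have h := hd _ (hty t ht)
  rw [← hd' t ht] at h
  simp only [← hd' t ht, ← h]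
  exact he.toETyping.den_append [t] (ρ := [_]) rfl

theorem unit : RSFun γ .unit (fun _ => .unit) := ⟨.unit, .unit, fun _ _ => rfl⟩

theorem pair (hF : RSFun γ γ₁ F) (hG : RSFun γ γ₂ G) :
    RSFun γ (.prod γ₁ γ₂) (fun t => .pair (F t) (G t)) := by
  obtain ⟨e, he, hd⟩ := hF
  obtain ⟨e', he', hd'⟩ := hG
  exact ⟨.pair e e', .pair he he', fun t ht => by simp [Term.den, hd t ht, hd' t ht]⟩

theorem fst (hF : RSFun γ (.prod γ₁ γ₂) F) : RSFun γ γ₁ (fun t => (F t).fst) := by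
  obtain ⟨e, he, hd⟩ := hF
  exact ⟨.fst e, .fst he, fun t ht => by simp [Term.den, hd t ht]⟩

theorem snd (hF : RSFun γ (.prod γ₁ γ₂) F) : RSFun γ γ₂ (fun t => (F t).snd) := by
  obtain ⟨e, he, hd⟩ := hF
  exact ⟨.snd e, .snd he, fun t ht => by simp [Term.den, hd t ht]⟩

theorem inl (hF : RSFun γ γ₁ F) (hγ : γ₂.Admissible) :
    RSFun γ (.sum γ₁ γ₂) (fun t => .inl (F t)) := by
  obtain ⟨e, he, hd⟩ := hF
  exact ⟨.inl e, .inl hγ he, fun t ht => by simp [Term.den, hd t ht]⟩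

theorem inr (hF : RSFun γ γ₂ F) (hγ : γ₁.Admissible) :
    RSFun γ (.sum γ₁ γ₂) (fun t => .inr (F t)) := by
  obtain ⟨e, he, hd⟩ := hF
  exact ⟨.inr e, .inr hγ he, fun t ht => by simp [Term.den, hd t ht]⟩

theorem safeCon (hF : RSFun γ (P.app (.mu P)).toSafe F) (hP : (Ground.mu P).Admissible) :
    RSFun γ (.safeMu P) (fun t => .con P (F t)) := by
  obtain ⟨e, he, hd⟩ := hF
  exact ⟨.safeCon P e, .safeCon hP he, fun t ht => by simp [Term.den, hd t ht]⟩

theorem safeDestr (hF : RSFun γ (.safeMu P) F) :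
    RSFun γ (P.app (.mu P)).toSafe (fun t => (F t).destr) := by
  obtain ⟨e, he, hd⟩ := hF
  exact ⟨.safeDestr P e, .safeDestr he, fun t ht => by simp [Term.den, hd t ht]⟩

theorem toSafe (hF : RSFun γ δ F) : RSFun γ δ.toSafe F := by
  obtain ⟨e, he, hd⟩ := hF
  exact ⟨.toSafe e, .toSafe he, hd⟩

/-- The only possible free variable has the normal type `γ`. This is how the safe result of one
recursion can come to control another. -/
theorem toNormal (hF : RSFun γ δ F) (hγ : γ.IsNormal) : RSFun γ δ.toNormal F := by
  obtain ⟨e, he, hd⟩ := hF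
  refine ⟨.toNorm e, .toNorm (fun i γ' _ hi => ?_) he, hd⟩
  cases i <;> simp_all

/-- A term with an additional, innermost variable, obtained from a function of pairs. -/
theorem exists_binder (hF : RSFun (.prod γ₁ γ) δ F) (hγ₁ : γ₁.Admissible) (hγ : γ.Admissible) :
    ∃ e, RSTyping [γ₁, γ] e (.ground δ) ∧
      ∀ x t, x.HasTy γ₁ → t.HasTy γ → e.den [x, t] = F (.pair x t) := by
  obtain ⟨e, he, hd⟩ := hF
  have hp : (Ground.prod γ₁ γ).Admissible := ⟨hγ₁, hγ⟩
  refine ⟨.app (.lam e) (.pair (.var 0) (.var 1)),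
    .app (.lam hp (he.append [γ₁, γ])) (.pair (.var hγ₁ rfl) (.var hγ rfl)),
    fun x t hx ht => ?_⟩
  rw [← hd (.pair x t) ⟨hx, ht⟩]
  exact he.toETyping.den_append [x, t] (ρ := [_]) rfl

theorem caseOf (hγ : γ.Admissible) (hside : (Ground.sum γ₁ γ₂).IsNormal ∨ δ.IsSafe)
    (hF : RSFun γ (.sum γ₁ γ₂) F) (hG : RSFun (.prod γ₁ γ) δ G) (hH : RSFun (.prod γ₂ γ) δ H) :
    RSFun γ δ (fun t => (F t).caseOf (fun x => G (.pair x t)) (fun x => H (.pair x t))) := by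
  have hadm := hF.admissible
  have hty := fun t => hF.hasTy (t := t)
  obtain ⟨e, he, hd⟩ := hF
  obtain ⟨e₁, he₁, hd₁⟩ := hG.exists_binder hadm.1 hγ
  obtain ⟨e₂, he₂, hd₂⟩ := hH.exists_binder hadm.2 hγ
  refine ⟨.case e e₁ e₂, .case hside he he₁ he₂, fun t ht => ?_⟩
  simp only [Term.den, hd t ht]
  obtain ⟨u, hu, hu'⟩ | ⟨u, hu, hu'⟩ := Tree.hasTy_sum_iff.1 (hty t ht)
  · simp only [hu, Tree.caseOf, hd₁ u t hu' ht]
  · simp only [hu, Tree.caseOf, hd₂ u t hu' ht]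

theorem fold (hγ : γ.Admissible) (hσ : σ.IsSafe) (hF : RSFun γ (.mu P) F)
    (hG : RSFun (.prod (P.app σ) γ) σ G) :
    RSFun γ σ (fun t => (F t).mapFold P (fun x => G (.pair x t)) .id) := by
  have hP := (show (Ground.mu P).Admissible from hF.admissible).2.admissible_app hG.admissible
  have hty := fun t => hF.hasTy (t := t)
  obtain ⟨e, he, hd⟩ := hF
  obtain ⟨e₁, he₁, hd₁⟩ := hG.exists_binder hP hγ
  refine ⟨.fold P (.lam e₁) e, ?_, fun t ht => ?_⟩
  · rw [← hσ.toSafe_eq] at he₁ hP ⊢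
    exact .fold (.lam hP he₁) he
  · simp only [Term.den, hd t ht]
    exact Tree.mapFold_congr (σ := σ) (fun x hx => hG.hasTy (t := .pair x t) ⟨hx, ht⟩)
      (fun x hx => hd₁ x t hx ht) _ .id (hty t ht)

end RSFun

theorem RSFun.const {γ δ : Ground} {t : Tree} (hδ : δ.Admissible) (ht : t.HasTy δ) :
    RSFun γ δ (fun _ => t) := by
  suffices h : ∃ e, RSTyping [γ] e (.ground δ) ∧ ∀ ρ, e.den ρ = t from
    h.imp fun e he => ⟨he.1, fun _ _ => he.2 _⟩
  induction t generalizing δ with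
  | unit =>
    cases δ <;> simp only [Tree.HasTy] at ht
    · exact ⟨.unit, .unit, fun _ => rfl⟩
    · exact ⟨.toSafe .unit, .toSafe .unit, fun _ => rfl⟩
  | inl t ih =>
    cases δ <;> simp only [Tree.HasTy] at ht
    obtain ⟨e, he, hd⟩ := ih hδ.1 ht
    exact ⟨.inl e, .inl hδ.2 he, fun _ => congrArg _ (hd _)⟩
  | inr t ih =>
    cases δ <;> simp only [Tree.HasTy] at ht
    obtain ⟨e, he, hd⟩ := ih hδ.2 ht
    exact ⟨.inr e, .inr hδ.1 he, fun _ => congrArg _ (hd _)⟩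
  | pair t u iht ihu =>
    cases δ <;> simp only [Tree.HasTy] at ht
    obtain ⟨e, he, hd⟩ := iht hδ.1 ht.1
    obtain ⟨e', he', hd'⟩ := ihu hδ.2 ht.2
    exact ⟨.pair e e', .pair he he', fun _ => congrArg₂ _ (hd _) (hd' _)⟩
  | con P t ih =>
    cases δ <;> simp only [Tree.HasTy] at ht
    · obtain ⟨rfl, ht⟩ := ht
      obtain ⟨e, he, hd⟩ := ih (Ground.admissible_app_mu hδ) ht
      exact ⟨.con P e, .con hδ he, fun _ => congrArg _ (hd _)⟩
    · obtain ⟨rfl, ht⟩ := ht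
      obtain ⟨e, he, hd⟩ := ih (Ground.admissible_app_mu hδ) ht
      exact ⟨.safeCon P (.toSafe e), .safeCon hδ (.toSafe he), fun _ => congrArg _ (hd _)⟩

/-- Supplies default results for reading from an empty value stack. -/
theorem Ground.Admissible.exists_hasTy {γ : Ground} (hγ : γ.Admissible) :
    ∃ t : Tree, t.HasTy γ := by
  induction γ with
  | unit | safeUnit => exact ⟨.unit, trivial⟩
  | mu P | safeMu P =>
    obtain ⟨h, a, ha⟩ := hγ.1
    obtain ⟨t, -, ht⟩ := ha.exists_rep
    obtain ⟨u, rfl, hu⟩ := Tree.hasTy_mu_iff.1 ht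
    exact ⟨.con P u, rfl, hu⟩
  | sum γ₁ γ₂ ih₁ ih₂ => obtain ⟨t, ht⟩ := ih₁ hγ.1; exact ⟨.inl t, ht⟩
  | prod γ₁ γ₂ ih₁ ih₂ =>
    obtain ⟨t, ht⟩ := ih₁ hγ.1
    obtain ⟨u, hu⟩ := ih₂ hγ.2
    exact ⟨.pair t u, ht, hu⟩

/-! ### Natural numbers and iteration -/

/-- The functor whose least fixed point is the type of natural numbers. -/
abbrev natPoly : Poly := .sum .constUnit .id

/-- The numeral of a natural number. -/
def natTree : ℕ → Tree
  | 0 => .con natPoly (.inl .unit)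
  | n + 1 => .con natPoly (.inr (natTree n))

theorem hasTy_natTree (n : ℕ) : (natTree n).HasTy (.mu natPoly) := by
  induction n with
  | zero => exact ⟨rfl, trivial⟩
  | succ n ih => exact ⟨rfl, ih⟩

theorem hasTy_safe_natTree (n : ℕ) : (natTree n).HasTy (.safeMu natPoly) :=
  Tree.hasTy_toSafe (γ := .mu natPoly).2 (hasTy_natTree n)

theorem admissible_nat : (Ground.mu natPoly).Admissible :=
  ⟨⟨[.unit, .inl 0, .con natPoly 1], 2, .con rfl (.inl rfl (.unit rfl))⟩, trivial, trivial⟩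

/-- A loop with a normal bound and a safe state, obtained as a fold over the numeral. The step
distinguishes cases on a sum containing the safe state, which is permitted because its result is
safe. -/
theorem RSFun.iterate {γ σ : Ground} {N I S : Tree → Tree} (hγ : γ.Admissible) (hσ : σ.IsSafe)
    (hN : RSFun γ (.mu natPoly) N) (hI : RSFun γ σ I) (hS : RSFun (.prod σ γ) σ S) :
    ∃ F, RSFun γ σ F ∧
      ∀ t n, N t = natTree n → F t = (fun s => S (.pair s t))^[n] (I t) := by
  have hσ' := hI.admissible
  have hx : (Ground.prod (.sum .unit σ) γ).Admissible := ⟨⟨trivial, hσ'⟩, hγ⟩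
  have hunit := RSFun.id (γ := .prod .unit (.prod (.sum .unit σ) γ)) ⟨trivial, hx⟩
  have hstep := RSFun.id (γ := .prod σ (.prod (.sum .unit σ) γ)) ⟨hσ', hx⟩
  have hG := RSFun.caseOf hx (.inr hσ) (RSFun.id hx).fst (hI.comp hunit.snd.snd)
    (hS.comp (hstep.fst.pair hstep.snd.snd))
  refine ⟨_, RSFun.fold (P := natPoly) hγ hσ hN hG, fun t n hn => ?_⟩
  simp only [hn]
  clear hn
  induction n with
  | zero => simp [natTree, Tree.mapFold, Tree.fst, Tree.snd, Tree.caseOf]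
  | succ n ih =>
    rw [Function.iterate_succ_apply', ← ih]
    simp [natTree, Tree.mapFold, Tree.fst, Tree.snd, Tree.caseOf]

theorem RSFun.natSucc {γ : Ground} {F : Tree → Tree} (hF : RSFun γ (.safeMu natPoly) F) :
    RSFun γ (.safeMu natPoly) (fun t => .con natPoly (.inr (F t))) :=
  RSFun.safeCon (P := natPoly) (hF.inr (γ₁ := .safeUnit) trivial) admissible_nat

/-- The recursion is on the normal second summand; the first is only extended by successors and may
be safe. This asymmetry lets addition serve as the body of a loop with a safe state. -/
theorem RSFun.exists_add :
    ∃ K, RSFun (.prod (.safeMu natPoly) (.mu natPoly)) (.safeMu natPoly) K ∧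
      ∀ m n, K (.pair (natTree m) (natTree n)) = natTree (m + n) := by
  have hadm : (Ground.prod (.safeMu natPoly) (.mu natPoly)).Admissible :=
    ⟨admissible_nat, admissible_nat⟩
  have hid := RSFun.id hadm
  obtain ⟨K, hK, hK'⟩ := RSFun.iterate (σ := .safeMu natPoly) hadm trivial hid.snd hid.fst
    (RSFun.id (γ := .prod (.safeMu natPoly) (.prod (.safeMu natPoly) (.mu natPoly)))
      ⟨admissible_nat, hadm⟩).fst.natSucc
  refine ⟨K, hK, fun m n => ?_⟩
  refine (hK' _ n rfl).trans ?_
  suffices h : ∀ t, (fun s => Tree.con natPoly (s.pair t).fst.inr)^[n] (natTree m) =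
      natTree (m + n) from h _
  intro t
  induction n with
  | zero => simp
  | succ n ih =>
    rw [Function.iterate_succ_apply', ih]
    rfl

/-- Every polynomial is computed on normal numerals. -/
theorem RSFun.polynomial (q : Polynomial ℕ) :
    ∃ F, RSFun (.mu natPoly) (.mu natPoly) F ∧ ∀ n, F (natTree n) = natTree (q.eval n) := by
  obtain ⟨K, hK, hK'⟩ := RSFun.exists_add
  induction q using Polynomial.induction_on with
  | C a =>
    exact ⟨_, RSFun.const admissible_nat (hasTy_natTree a), fun n => by simp⟩
  | add p q hp hq =>
    obtain ⟨F, hF, hF'⟩ := hp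
    obtain ⟨G, hG, hG'⟩ := hq
    exact ⟨_, (hK.comp (hF.toSafe.pair hG)).toNormal trivial, fun n => by
      simp only [hF', hG', hK', Polynomial.eval_add]⟩
  | monomial k a ih =>
    obtain ⟨F, hF, hF'⟩ := ih
    -- Multiplication by the input `n`: starting from 0, the loop adds the normal numeral `n` to the
    -- safe state as many times as the previous monomial says.
    obtain ⟨M, hM, hM'⟩ := RSFun.iterate (σ := .safeMu natPoly) admissible_nat trivial hF
      (RSFun.const (t := natTree 0) admissible_nat (hasTy_safe_natTree 0)) hK
    refine ⟨M, hM.toNormal trivial, fun n => ?_⟩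
    rw [hM' _ _ (hF' n), pow_succ, ← mul_assoc, Polynomial.eval_mul_X]
    generalize Polynomial.eval n _ = m
    induction m with
    | zero => simp
    | succ m ih =>
      rw [Function.iterate_succ_apply', ih, hK', Nat.succ_mul]

/-! ### Lists -/

/-- The constant functor at the normal version of a ground type. -/
def Poly.const : Ground → Poly
  | .unit => .constUnit
  | .mu P => .constMu P
  | .safeUnit => .constUnit
  | .safeMu P => .constMu P
  | .sum γ₁ γ₂ => .sum (Poly.const γ₁) (Poly.const γ₂)
  | .prod γ₁ γ₂ => .prod (Poly.const γ₁) (Poly.const γ₂)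

@[simp] theorem Poly.toSafe_app_const (γ δ : Ground) :
    ((Poly.const γ).app δ).toSafe = γ.toSafe := by
  induction γ <;> simp_all [Poly.const, Poly.app, Ground.toSafe]

theorem Poly.constsInhabited_const {γ : Ground} (hγ : γ.Admissible) :
    (Poly.const γ).ConstsInhabited := by
  induction γ <;> simp_all [Poly.const, Ground.Admissible, Poly.ConstsInhabited]

/-- The functor whose least fixed point is the type of lists over `γ`. -/
abbrev listPoly (γ : Ground) : Poly := .sum .constUnit (.prod (.const γ) .id)

theorem listPoly_app_toSafe (γ : Ground) : ((listPoly γ).app (.mu (listPoly γ))).toSafe =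
    .sum .safeUnit (.prod γ.toSafe (.safeMu (listPoly γ))) := by
  simp [Poly.app, Ground.toSafe]

theorem admissible_list {γ : Ground} (hγ : γ.Admissible) : (Ground.mu (listPoly γ)).Admissible :=
  ⟨⟨[.unit, .inl 0, .con (listPoly γ) 1], 2, .con rfl (.inl rfl (.unit rfl))⟩, trivial,
    Poly.constsInhabited_const hγ, trivial⟩

namespace Tree

/-- The empty list. -/
def nil (γ : Ground) : Tree := con (listPoly γ) (inl unit)

/-- The list with a given head and tail. -/
def cons (γ : Ground) (t l : Tree) : Tree := con (listPoly γ) (inr (pair t l))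

/-- The tree of a list. -/
def ofList (γ : Ground) : List Tree → Tree
  | [] => nil γ
  | t :: ts => cons γ t (ofList γ ts)

end Tree

namespace RSFun

variable {γ δ σ : Ground} {F G H : Tree → Tree}

theorem nil (hδ : δ.Admissible) : RSFun γ (.safeMu (listPoly δ)) (fun _ => .nil δ) := by
  refine RSFun.safeCon (F := fun _ => .inl .unit) ?_ (admissible_list hδ)
  rw [listPoly_app_toSafe]
  exact RSFun.unit.toSafe.inl ⟨by simpa, admissible_list hδ⟩

theorem cons (hF : RSFun γ δ.toSafe F) (hG : RSFun γ (.safeMu (listPoly δ)) G) :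
    RSFun γ (.safeMu (listPoly δ)) (fun t => .cons δ (F t) (G t)) := by
  refine RSFun.safeCon (F := fun t => .inr (.pair (F t) (G t))) ?_
    (admissible_list (by simpa using hF.admissible))
  rw [listPoly_app_toSafe]
  exact (hF.pair hG).inr trivial

theorem listCase (hγ : γ.Admissible) (hσ : σ.IsSafe) (hF : RSFun γ (.safeMu (listPoly δ)) F)
    (hG : RSFun γ σ G) (hH : RSFun (.prod (.prod δ.toSafe (.safeMu (listPoly δ))) γ) σ H) :
    RSFun γ σ (fun t => (F t).destr.caseOf (fun _ => G t) (fun x => H (.pair x t))) := by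
  have hd := hF.safeDestr
  rw [listPoly_app_toSafe] at hd
  exact RSFun.caseOf hγ (.inr hσ) hd
    (hG.comp (RSFun.id (γ := .prod .safeUnit γ) ⟨trivial, hγ⟩).snd) hH

end RSFun

/-! ### Structural recursion on safe data -/

namespace Tree

/-- The immediate subtrees of type `μ P` of a tree of type `Q(μ P)`. -/
def kids : Poly → Tree → List Tree
  | .id, t => [t]
  | .sum Q _, inl t => kids Q t
  | .sum _ Q, inr t => kids Q t
  | .prod Q₁ Q₂, pair t u => kids Q₁ t ++ kids Q₂ u
  | _, _ => []

theorem flatMap_preorder_kids {P : Poly} (Q : Poly) : ∀ t,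
    (kids Q t).flatMap (preorder P .id) = preorder P Q t := by
  induction Q <;> intro t <;> cases t <;> simp_all [kids, preorder]

theorem hasTy_kids {P : Poly} (Q : Poly) : ∀ {t : Tree}, t.HasTy (Q.app (.mu P)) →
    ∀ u ∈ kids Q t, u.HasTy (.mu P) := by
  induction Q with
  | sum Q₁ Q₂ ih₁ ih₂ =>
    intro t ht u hu
    obtain ⟨v, rfl, hv⟩ | ⟨v, rfl, hv⟩ := hasTy_sum_iff.1 ht
    · exact ih₁ hv u hu
    · exact ih₂ hv u hu
  | prod Q₁ Q₂ ih₁ ih₂ =>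
    intro t ht u hu
    obtain ⟨v, w, rfl, hv, hw⟩ := hasTy_prod_iff.1 ht
    exact (List.mem_append.1 hu).elim (ih₁ hv u) (ih₂ hw u)
  | _ => intro t ht u hu; simp_all [Poly.app, kids]

/-- Traversing a forest: in each step, the first tree moves to the output and its children
replace it. -/
theorem traverse_iterate {P : Poly} {γ δ : Ground} {S : Tree → Tree}
    (hnil : ∀ out, S (.pair (.nil γ) out) = .pair (.nil γ) out)
    (hcons : ∀ t ts out, t.HasTy (P.app (.mu P)) →
      S (.pair (.ofList γ (con P t :: ts)) (.ofList δ out)) =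
        .pair (.ofList γ (kids P t ++ ts)) (.ofList δ (con P t :: out)))
    (n : ℕ) : ∀ ts out : List Tree,
    (∀ t ∈ ts, t.HasTy (.mu P)) → (ts.flatMap (preorder P .id)).length ≤ n →
    S^[n] (.pair (.ofList γ ts) (.ofList δ out)) =
      .pair (.nil γ) (.ofList δ ((ts.flatMap (preorder P .id)).reverse ++ out)) := by
  have fixed (n : ℕ) (out : List Tree) : S^[n] (.pair (.nil γ) (.ofList δ out)) =
      .pair (.nil γ) (.ofList δ out) := Function.iterate_fixed (hnil _) n
  induction n with
  | zero =>
    intro ts out hts hn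
    cases ts with
    | nil => rfl
    | cons t ts =>
      obtain ⟨u, rfl, -⟩ := hasTy_mu_iff.1 (hts t (by simp))
      simp [preorder] at hn
  | succ n ih =>
    intro ts out hts hn
    cases ts with
    | nil => exact fixed _ out
    | cons t ts =>
      obtain ⟨u, rfl, hu⟩ := hasTy_mu_iff.1 (hts t (by simp))
      rw [Function.iterate_succ_apply, hcons u ts out hu, ih]
      · simp [flatMap_preorder_kids, preorder]
      · intro x hx
        rcases List.mem_append.1 hx with hx | hx
        · exact hasTy_kids P hu x hx
        · exact hts x (by simp [hx])
      · simp only [List.flatMap_cons, preorder, List.length_append, List.length_cons,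
          List.flatMap_append, flatMap_preorder_kids] at hn ⊢
        omega

/-- Evaluating a preorder traversal backwards with a stack of values: in each step, the values of
the children are popped and the value of the tree is pushed. -/
theorem evaluate_iterate {P : Poly} {γ δ : Ground} {S g : Tree → Tree}
    (hS : ∀ t ts vs, t.HasTy (P.app (.mu P)) →
      S (.pair (.ofList γ (con P t :: ts))
          (.ofList δ ((t.kids P).map (mapFold P g .id) ++ vs))) =
        .pair (.ofList γ ts) (.ofList δ (g (mapFold P g P t) :: vs)))
    (t : Tree) : ∀ (Q : Poly) (ts vs : List Tree), t.HasTy (Q.app (.mu P)) →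
    S^[(preorder P Q t).length]
        (.pair (.ofList γ ((preorder P Q t).reverse ++ ts)) (.ofList δ vs)) =
      .pair (.ofList γ ts) (.ofList δ ((t.kids Q).map (mapFold P g .id) ++ vs)) := by
  induction t with
  | con c t ih =>
    intro Q ts vs ht
    cases Q <;> simp only [Poly.app, HasTy] at ht
    · obtain ⟨rfl, ht⟩ := ht
      -- In the reversed preorder the root comes last, when the values of its children are already
      -- on top of the stack.
      simp only [preorder, List.length_cons, List.reverse_cons, List.append_assoc,
        List.singleton_append, Function.iterate_succ_apply', ih c _ vs ht, hS t ts vs ht]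
      rfl
    · rfl
  | unit =>
    intro Q ts vs ht
    cases Q <;> simp only [Poly.app, HasTy] at ht
    rfl
  | inl t ih | inr t ih =>
    intro Q ts vs ht
    cases Q <;> simp only [Poly.app, HasTy] at ht
    exact ih _ ts vs ht
  | pair t u iht ihu =>
    intro Q ts vs ht
    cases Q <;> simp only [Poly.app, HasTy] at ht
    simp only [preorder, List.length_append, List.reverse_append, List.append_assoc, kids,
      List.map_append, Function.iterate_add_apply, ihu _ _ _ ht.2, iht _ _ _ ht.1]

end Tree

section SafeFold

variable {γ : Ground} {P : Poly}

/-- The recursion on `Q` takes place outside the calculus: the resulting term uses only projections,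
cases and list constructors, so it can act on safe trees. -/
theorem RSFun.exists_pushKids (hP : (Ground.mu P).Admissible) (Q : Poly)
    (hQ : Q.ConstsInhabited) :
    ∃ F, RSFun (.prod (Q.app (.mu P)).toSafe (.safeMu (listPoly (.mu P))))
        (.safeMu (listPoly (.mu P))) F ∧
      ∀ t ts, t.HasTy (Q.app (.mu P)) →
        F (.pair t (.ofList (.mu P) ts)) = .ofList (.mu P) (t.kids Q ++ ts) := by
  have hl := admissible_list hP
  have adm (Q : Poly) (hQ : Q.ConstsInhabited) :
      (Ground.prod (Q.app (.mu P)).toSafe (.safeMu (listPoly (.mu P)))).Admissible :=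
    ⟨Ground.admissible_toSafe.2 (hQ.admissible_app hP), hl⟩
  induction Q with
  | id =>
    have hid := RSFun.id (adm .id trivial)
    exact ⟨_, RSFun.cons (δ := .mu P) hid.fst hid.snd, fun t ts _ => rfl⟩
  | constUnit => exact ⟨_, (RSFun.id (adm .constUnit trivial)).snd, fun t ts _ => by
      cases t <;> rfl⟩
  | constMu R => exact ⟨_, (RSFun.id (adm (.constMu R) hQ)).snd, fun t ts _ => by
      cases t <;> rfl⟩
  | sum Q₁ Q₂ ih₁ ih₂ =>
    obtain ⟨F₁, hF₁, hF₁'⟩ := ih₁ hQ.1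
    obtain ⟨F₂, hF₂, hF₂'⟩ := ih₂ hQ.2
    have hadm := adm (.sum Q₁ Q₂) hQ
    have hid := RSFun.id hadm
    have hid₁ := RSFun.id (γ := .prod (Q₁.app (.mu P)).toSafe
      (.prod ((Poly.sum Q₁ Q₂).app (.mu P)).toSafe _)) ⟨(adm Q₁ hQ.1).1, hadm⟩
    have hid₂ := RSFun.id (γ := .prod (Q₂.app (.mu P)).toSafe
      (.prod ((Poly.sum Q₁ Q₂).app (.mu P)).toSafe _)) ⟨(adm Q₂ hQ.2).1, hadm⟩
    refine ⟨_, RSFun.caseOf hadm (.inr trivial) hid.fst (hF₁.comp (hid₁.fst.pair hid₁.snd.snd))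
      (hF₂.comp (hid₂.fst.pair hid₂.snd.snd)), fun t ts ht => ?_⟩
    obtain ⟨u, rfl, hu⟩ | ⟨u, rfl, hu⟩ := Tree.hasTy_sum_iff.1 ht
    · simpa [Tree.fst, Tree.snd, Tree.caseOf, Tree.kids] using hF₁' u ts hu
    · simpa [Tree.fst, Tree.snd, Tree.caseOf, Tree.kids] using hF₂' u ts hu
  | prod Q₁ Q₂ ih₁ ih₂ =>
    obtain ⟨F₁, hF₁, hF₁'⟩ := ih₁ hQ.1
    obtain ⟨F₂, hF₂, hF₂'⟩ := ih₂ hQ.2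
    have hid := RSFun.id (adm (.prod Q₁ Q₂) hQ)
    refine ⟨_, hF₁.comp (hid.fst.fst.pair (hF₂.comp (hid.fst.snd.pair hid.snd))),
      fun t ts ht => ?_⟩
    obtain ⟨u, v, rfl, hu, hv⟩ := Tree.hasTy_prod_iff.1 ht
    simp only [Tree.fst, Tree.snd, hF₂' v ts hv, hF₁' u _ hu, Tree.kids, List.append_assoc]

/-- The term rebuilds the shape of `t`, taking from the stack a value for each child, in the order
of `kids`. It does not depend on `g`, which enters only through the contents of the stack. -/
theorem RSFun.exists_popKids (hP : (Ground.mu P).Admissible) (hγ : γ.Admissible) (Q : Poly)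
    (hQ : Q.ConstsInhabited) :
    ∃ F, RSFun (.prod (Q.app (.mu P)).toSafe (.safeMu (listPoly γ)))
        (.prod (Q.app γ).toSafe (.safeMu (listPoly γ))) F ∧
      ∀ g t vs, t.HasTy (Q.app (.mu P)) →
        F (.pair t (.ofList γ ((t.kids Q).map (Tree.mapFold P g .id) ++ vs))) =
          .pair (t.mapFold P g Q) (.ofList γ vs) := by
  have hl := admissible_list hγ
  have adm (Q : Poly) (hQ : Q.ConstsInhabited) :
      (Ground.prod (Q.app (.mu P)).toSafe (.safeMu (listPoly γ))).Admissible :=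
    ⟨Ground.admissible_toSafe.2 (hQ.admissible_app hP), hl⟩
  induction Q with
  | id =>
    have hid := RSFun.id (adm .id trivial)
    obtain ⟨d, hd⟩ := hγ.exists_hasTy
    have hp : (Ground.prod γ.toSafe (.safeMu (listPoly γ))).Admissible := ⟨by simpa, hl⟩
    -- The default `d` answers for an empty stack, a case that the specification excludes.
    exact ⟨_, RSFun.listCase (adm .id trivial) (σ := .prod γ.toSafe (.safeMu (listPoly γ)))
      ⟨γ.isSafe_toSafe, trivial⟩ hid.snd
      ((RSFun.const (t := d) (by simpa) (by simpa)).pair (RSFun.nil hγ))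
      (RSFun.id (γ := .prod _ (.prod ((Poly.id).app (.mu P)).toSafe (.safeMu (listPoly γ))))
        ⟨hp, adm .id trivial⟩).fst, fun g t vs ht => rfl⟩
  | constUnit =>
    exact ⟨_, RSFun.id (adm .constUnit trivial), fun g t vs _ => by cases t <;> rfl⟩
  | constMu R =>
    exact ⟨_, RSFun.id (adm (.constMu R) hQ), fun g t vs _ => by cases t <;> rfl⟩
  | sum Q₁ Q₂ ih₁ ih₂ =>
    obtain ⟨F₁, hF₁, hF₁'⟩ := ih₁ hQ.1
    obtain ⟨F₂, hF₂, hF₂'⟩ := ih₂ hQ.2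
    have hadm := adm (.sum Q₁ Q₂) hQ
    have hid := RSFun.id hadm
    have hid₁ := RSFun.id (γ := .prod (Q₁.app (.mu P)).toSafe
      (.prod ((Poly.sum Q₁ Q₂).app (.mu P)).toSafe _)) ⟨(adm Q₁ hQ.1).1, hadm⟩
    have hid₂ := RSFun.id (γ := .prod (Q₂.app (.mu P)).toSafe
      (.prod ((Poly.sum Q₁ Q₂).app (.mu P)).toSafe _)) ⟨(adm Q₂ hQ.2).1, hadm⟩
    have hK₁ := hF₁.comp (hid₁.fst.pair hid₁.snd.snd)
    have hK₂ := hF₂.comp (hid₂.fst.pair hid₂.snd.snd)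
    have hs : (((Poly.sum Q₁ Q₂).app γ).toSafe.prod (.safeMu (listPoly γ))).IsSafe :=
      ⟨Ground.isSafe_toSafe _, trivial⟩
    refine ⟨_, RSFun.caseOf hadm (.inr hs) hid.fst
      ((hK₁.fst.inl (Ground.admissible_toSafe.2 (hQ.2.admissible_app hγ))).pair hK₁.snd)
      ((hK₂.fst.inr (Ground.admissible_toSafe.2 (hQ.1.admissible_app hγ))).pair hK₂.snd),
      fun g t vs ht => ?_⟩
    obtain ⟨u, rfl, hu⟩ | ⟨u, rfl, hu⟩ := Tree.hasTy_sum_iff.1 ht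
    · simp [Tree.fst, Tree.snd, Tree.caseOf, Tree.kids, Tree.mapFold, hF₁' g u vs hu]
    · simp [Tree.fst, Tree.snd, Tree.caseOf, Tree.kids, Tree.mapFold, hF₂' g u vs hu]
  | prod Q₁ Q₂ ih₁ ih₂ =>
    obtain ⟨F₁, hF₁, hF₁'⟩ := ih₁ hQ.1
    obtain ⟨F₂, hF₂, hF₂'⟩ := ih₂ hQ.2
    have hid := RSFun.id (adm (.prod Q₁ Q₂) hQ)
    have hK₁ := hF₁.comp (hid.fst.fst.pair hid.snd)
    have hK₂ := hF₂.comp (hid.fst.snd.pair hK₁.snd)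
    refine ⟨_, (hK₁.fst.pair hK₂.fst).pair hK₂.snd, fun g t vs ht => ?_⟩
    obtain ⟨u, v, rfl, hu, hv⟩ := Tree.hasTy_prod_iff.1 ht
    simp [Tree.fst, Tree.snd, Tree.kids, Tree.mapFold, hF₁' g u _ hu, hF₂' g v vs hv]

/-- Structural recursion on safe data is definable, given a normal numeral that bounds the number
of recursive calls. -/
theorem RSFun.exists_safeFold {δ : Ground} {N T F : Tree → Tree} (hδ : δ.Admissible)
    (hN : RSFun δ (.mu natPoly) N) (hT : RSFun δ (.safeMu P) T)
    (hF : RSFun (.prod (P.app γ).toSafe δ) γ.toSafe F) :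
    ∃ G, RSFun δ γ.toSafe G ∧ ∀ t n, t.HasTy δ → N t = natTree n →
      ((T t).preorder P .id).length ≤ n →
      G t = (T t).mapFold P (fun x => F (.pair x t)) .id := by
  have hγ : γ.Admissible := by simpa using hF.admissible
  have hP : (Ground.mu P).Admissible := hT.admissible
  obtain ⟨push, hpush, hpush'⟩ := RSFun.exists_pushKids hP P hP.2
  obtain ⟨pop, hpop, hpop'⟩ := RSFun.exists_popKids hP hγ P hP.2
  have hlP := admissible_list hP
  have hlγ := admissible_list hγ
  let ε₁ : Ground := .safeMu (listPoly (.mu P))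
  let ε₂ : Ground := .safeMu (listPoly γ)
  have hnil₁ := RSFun.nil (γ := δ) hP
  have hid₁ := RSFun.id (γ := .prod (.prod ε₁ ε₁) δ) ⟨⟨hlP, hlP⟩, hδ⟩
  have hid₁' := RSFun.id (γ := .prod (.prod (.safeMu P) ε₁) (.prod (.prod ε₁ ε₁) δ))
    ⟨⟨hP, hlP⟩, ⟨hlP, hlP⟩, hδ⟩
  -- State: the forest still to be visited and the output list. An empty forest leaves the state
  -- unchanged.
  obtain ⟨A, hA, hA'⟩ := RSFun.iterate (σ := .prod ε₁ ε₁) hδ ⟨trivial, trivial⟩ hN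
    ((RSFun.cons (δ := .mu P) hT hnil₁).pair hnil₁)
    (RSFun.listCase (δ := .mu P) ⟨⟨hlP, hlP⟩, hδ⟩ ⟨trivial, trivial⟩ hid₁.fst.fst hid₁.fst
      ((hpush.comp (hid₁'.fst.fst.safeDestr.pair hid₁'.fst.snd)).pair
        (RSFun.cons (δ := .mu P) hid₁'.fst.fst hid₁'.snd.fst.snd)))
  have hid₂ := RSFun.id (γ := .prod (.prod ε₁ ε₂) δ) ⟨⟨hlP, hlγ⟩, hδ⟩
  have hid₂' := RSFun.id (γ := .prod (.prod (.safeMu P) ε₁) (.prod (.prod ε₁ ε₂) δ))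
    ⟨⟨hP, hlP⟩, ⟨hlP, hlγ⟩, hδ⟩
  have hpopped := hpop.comp (hid₂'.fst.fst.safeDestr.pair hid₂'.snd.fst.snd)
  -- State: the trees still to be evaluated and the stack of values. The first loop has accumulated
  -- its output in reverse, which is exactly the order needed here.
  obtain ⟨B, hB, hB'⟩ := RSFun.iterate (σ := .prod ε₁ ε₂) hδ ⟨trivial, trivial⟩ hN
    (hA.snd.pair (RSFun.nil hγ))
    (RSFun.listCase (δ := .mu P) ⟨⟨hlP, hlγ⟩, hδ⟩ ⟨trivial, trivial⟩ hid₂.fst.fst hid₂.fst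
      (hid₂'.fst.snd.pair (RSFun.cons (δ := γ) (hF.comp (hpopped.fst.pair hid₂'.snd.snd))
        hpopped.snd)))
  obtain ⟨d, hd⟩ := hγ.exists_hasTy
  have hp : (Ground.prod γ.toSafe ε₂).Admissible := ⟨by simpa, hlγ⟩
  refine ⟨_, RSFun.listCase hδ γ.isSafe_toSafe hB.snd (RSFun.const (t := d) (by simpa) (by simpa))
    (RSFun.id (γ := .prod (.prod γ.toSafe ε₂) δ) ⟨hp, hδ⟩).fst.fst, fun t n ht hn hlen => ?_⟩
  have hTt : (T t).HasTy (.mu P) := Tree.hasTy_toSafe (γ := .mu P).1 (hT.hasTy ht)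
  have hAt : A t = .pair (.nil (.mu P)) (.ofList (.mu P) ((T t).preorder P .id).reverse) := by
    rw [hA' t n hn]
    refine (Tree.traverse_iterate (P := P) (γ := .mu P) (δ := .mu P) (fun out => rfl)
      (fun u us out hu => ?_) n [T t] [] (by simpa using hTt) (by simpa using hlen)).trans
      (by simp)
    simp only [Tree.ofList, Tree.cons, Tree.fst, Tree.snd, Tree.destr, Tree.caseOf, hpush' u us hu]
  have hBt : B t = .pair (.nil (.mu P))
      (.ofList γ [(T t).mapFold P (fun x => F (.pair x t)) .id]) := by
    rw [hB' t n hn, hAt]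
    -- Only as many rounds as there are listed trees do any work; the remaining `m` find an empty
    -- list and fix the state.
    obtain ⟨m, rfl⟩ := Nat.exists_eq_add_of_le' hlen
    rw [Function.iterate_add_apply]
    have h := Tree.evaluate_iterate (P := P) (γ := .mu P) (δ := γ)
      (g := fun x => F (.pair x t)) (S := fun s => Tree.caseOf s.fst.destr (fun _ => s)
        fun x => .pair x.snd (.cons γ
          (F (.pair (pop (.pair x.fst.destr s.snd)).fst t)) (pop (.pair x.fst.destr s.snd)).snd))
      (fun u us vs hu => by
        simp only [Tree.ofList, Tree.cons, Tree.fst, Tree.snd, Tree.destr, Tree.caseOf,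
          hpop' _ u vs hu])
      (T t) .id [] [] hTt
    simp only [List.append_nil] at h
    refine (congrArg _ h).trans ?_
    exact Function.iterate_fixed rfl m
  simp only [hBt]
  rfl

end SafeFold

/-! ### Translation of the unramified calculus -/

/-- The safe product of the types in a context. -/
def ctxTy : Ctx → Ground
  | [] => .safeUnit
  | γ :: Γ => .prod γ.toSafe (ctxTy Γ)

/-- The tuple of the values in an environment. -/
def envTree : List Tree → Tree
  | [] => .unit
  | t :: ρ => .pair t (envTree ρ)

theorem admissible_ctxTy {Γ : Ctx} (h : ∀ γ ∈ Γ, γ.Admissible) : (ctxTy Γ).Admissible := by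
  induction Γ <;> simp_all [ctxTy, Ground.Admissible]

theorem EnvTy.hasTy_envTree {ρ : List Tree} {Γ : Ctx} (h : EnvTy ρ Γ) :
    (envTree ρ).HasTy (ctxTy Γ) := by
  induction h with
  | nil => trivial
  | cons ht _ ih => exact ⟨Tree.hasTy_toSafe.2 ht, ih⟩

theorem RSFun.exists_lookup {Γ : Ctx} (hΓ : ∀ γ ∈ Γ, γ.Admissible) {i : ℕ} {γ : Ground}
    (hi : Γ[i]? = some γ) : ∃ F, RSFun (ctxTy Γ) γ.toSafe F ∧
      ∀ ρ, EnvTy ρ Γ → F (envTree ρ) = ρ[i]?.getD .unit := by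
  induction Γ generalizing i with
  | nil => simp at hi
  | cons δ Γ ih =>
    have hid := RSFun.id (admissible_ctxTy hΓ)
    cases i with
    | zero =>
      obtain rfl : δ = γ := by simpa using hi
      refine ⟨_, hid.fst, fun ρ hρ => ?_⟩
      cases hρ
      rfl
    | succ i =>
      obtain ⟨F, hF, hF'⟩ := ih (fun γ hγ => hΓ γ (by simp [hγ])) (i := i) (by simpa using hi)
      refine ⟨_, hF.comp hid.snd, fun ρ hρ => ?_⟩
      cases hρ with
      | cons _ hρ => simpa [envTree, Tree.snd] using hF' _ hρ

/-- Every term of the unramified calculus is computed by a term of the ramified calculus with safe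
variables and a normal numeral that bounds the lengths of all structural recursions. -/
theorem STyping.exists_rsFun {Γ : Ctx} {e : Term} {τ : Ty} (h : STyping Γ e τ)
    (hΓ : ∀ γ ∈ Γ, γ.Admissible) :
    ∃ F, RSFun (.prod (.mu natPoly) (ctxTy (τ.extend Γ))) τ.result.toSafe F ∧
      ∀ n ρ, EnvTy ρ (τ.extend Γ) → e.foldBound ρ ≤ n →
        F (.pair (natTree n) (envTree ρ)) = e.den ρ := by
  have adm {Γ : Ctx} (hΓ : ∀ γ ∈ Γ, γ.Admissible) :
      (Ground.prod (.mu natPoly) (ctxTy Γ)).Admissible := ⟨admissible_nat, admissible_ctxTy hΓ⟩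
  induction h with
  | var hγ hi =>
    obtain ⟨F, hF, hF'⟩ := RSFun.exists_lookup hΓ hi
    exact ⟨_, hF.comp (RSFun.id (adm hΓ)).snd, fun n ρ hρ _ => hF' ρ hρ⟩
  | lam hγ he ih =>
    exact ih (List.forall_mem_cons.2 ⟨hγ.2, hΓ⟩)
  | app h₀ h₁ ih₀ ih₁ =>
    obtain ⟨F₀, hF₀, hF₀'⟩ := ih₀ hΓ
    obtain ⟨F₁, hF₁, hF₁'⟩ := ih₁ hΓ
    have hid := RSFun.id (adm hΓ)
    -- The same clock goes undiminished to both parts. This suffices because `foldBound` is a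
    -- maximum, not a sum.
    refine ⟨_, hF₀.comp (hid.fst.pair (hF₁.pair hid.snd)), fun n ρ hρ hn => ?_⟩
    obtain ⟨hn₁, hn₀⟩ := max_le_iff.1 hn
    simp only [Tree.fst, Tree.snd, hF₁' n ρ hρ hn₁]
    exact hF₀' n _ (.cons (h₁.toETyping.hasTy_den hρ) hρ) hn₀
  | unit => exact ⟨_, RSFun.unit.toSafe, fun n ρ _ _ => rfl⟩
  | pair h₁ h₂ ih₁ ih₂ =>
    obtain ⟨F₁, hF₁, hF₁'⟩ := ih₁ hΓ
    obtain ⟨F₂, hF₂, hF₂'⟩ := ih₂ hΓ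
    refine ⟨_, hF₁.pair hF₂, fun n ρ hρ hn => ?_⟩
    obtain ⟨hn₁, hn₂⟩ := max_le_iff.1 hn
    simp only [hF₁' n ρ hρ hn₁, hF₂' n ρ hρ hn₂, Term.den]
  | fst h ih =>
    obtain ⟨F, hF, hF'⟩ := ih hΓ
    exact ⟨_, RSFun.fst hF, fun n ρ hρ hn => congrArg _ (hF' n ρ hρ hn)⟩
  | snd h ih =>
    obtain ⟨F, hF, hF'⟩ := ih hΓ
    exact ⟨_, RSFun.snd hF, fun n ρ hρ hn => congrArg _ (hF' n ρ hρ hn)⟩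
  | inl hγ h ih =>
    obtain ⟨F, hF, hF'⟩ := ih hΓ
    exact ⟨_, hF.inl (Ground.admissible_toSafe.2 hγ.2),
      fun n ρ hρ hn => congrArg _ (hF' n ρ hρ hn)⟩
  | inr hγ h ih =>
    obtain ⟨F, hF, hF'⟩ := ih hΓ
    exact ⟨_, hF.inr (Ground.admissible_toSafe.2 hγ.2),
      fun n ρ hρ hn => congrArg _ (hF' n ρ hρ hn)⟩
  | @case Γ e₀ e₁ e₂ γ₁ γ₂ γ h₀ h₁ h₂ ih₀ ih₁ ih₂ =>
    have hγ := h₀.isSType.2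
    obtain ⟨F₀, hF₀, hF₀'⟩ := ih₀ hΓ
    obtain ⟨F₁, hF₁, hF₁'⟩ := ih₁ (List.forall_mem_cons.2 ⟨hγ.1, hΓ⟩)
    obtain ⟨F₂, hF₂, hF₂'⟩ := ih₂ (List.forall_mem_cons.2 ⟨hγ.2, hΓ⟩)
    have hid₁ := RSFun.id (γ := .prod γ₁.toSafe (.prod (.mu natPoly) (ctxTy Γ)))
      ⟨Ground.admissible_toSafe.2 hγ.1, adm hΓ⟩
    have hid₂ := RSFun.id (γ := .prod γ₂.toSafe (.prod (.mu natPoly) (ctxTy Γ)))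
      ⟨Ground.admissible_toSafe.2 hγ.2, adm hΓ⟩
    refine ⟨_, RSFun.caseOf (adm hΓ) (.inr (Ground.isSafe_toSafe _)) hF₀
      (hF₁.comp (hid₁.snd.fst.pair (hid₁.fst.pair hid₁.snd.snd)))
      (hF₂.comp (hid₂.snd.fst.pair (hid₂.fst.pair hid₂.snd.snd))), fun n ρ hρ hn => ?_⟩
    obtain ⟨hn₀, hn⟩ := max_le_iff.1 hn
    obtain ⟨u, hu, hu'⟩ | ⟨u, hu, hu'⟩ := Tree.hasTy_sum_iff.1 (h₀.toETyping.hasTy_den hρ)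
    · rw [hu] at hn
      simp only [hF₀' n ρ hρ hn₀, hu, Tree.caseOf, Tree.fst, Tree.snd, Term.den]
      exact hF₁' n _ (.cons hu' hρ) hn
    · rw [hu] at hn
      simp only [hF₀' n ρ hρ hn₀, hu, Tree.caseOf, Tree.fst, Tree.snd, Term.den]
      exact hF₂' n _ (.cons hu' hρ) hn
  | con hP h ih =>
    obtain ⟨F, hF, hF'⟩ := ih hΓ
    exact ⟨_, hF.safeCon hP.2, fun n ρ hρ hn => congrArg _ (hF' n ρ hρ hn)⟩
  | destr h ih =>
    obtain ⟨F, hF, hF'⟩ := ih hΓ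
    exact ⟨_, RSFun.safeDestr hF, fun n ρ hρ hn => congrArg _ (hF' n ρ hρ hn)⟩
  | @fold Γ P e₀ e₁ γ h₀ h₁ ih₀ ih₁ =>
    obtain ⟨F₀, hF₀, hF₀'⟩ := ih₀ hΓ
    obtain ⟨F₁, hF₁, hF₁'⟩ := ih₁ hΓ
    have hid := RSFun.id (γ := .prod (P.app γ).toSafe (.prod (.mu natPoly) (ctxTy Γ)))
      ⟨Ground.admissible_toSafe.2 h₀.isSType.1.2, adm hΓ⟩
    -- The parameter of the safe fold is the pair of clock and environment. The translated step
    -- function expects its argument inside the environment, hence the rearrangement.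
    obtain ⟨G, hG, hG'⟩ := RSFun.exists_safeFold (adm hΓ) (RSFun.id (adm hΓ)).fst hF₁
      (RSFun.comp hF₀ (hid.snd.fst.pair (hid.fst.pair hid.snd.snd)))
    refine ⟨G, hG, fun n ρ hρ hn => ?_⟩
    simp only [Term.foldBound, max_le_iff] at hn
    have hF₁ρ := hF₁' n ρ hρ hn.1
    rw [hG' (.pair _ _) n ⟨hasTy_natTree n, EnvTy.hasTy_envTree hρ⟩ rfl (by rw [hF₁ρ]; exact hn.2.1), hF₁ρ]
    -- The translated step function is known to be correct only on arguments whose own recursions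
    -- fit into the clock; the `foldSup` part of `foldBound` covers all arguments that arise.
    exact Tree.mapFold_congr_of_foldSup_le
      (fun x hx => h₀.toETyping.hasTy_den (.cons hx hρ))
      (fun x hx hB => hF₀' n (x :: ρ) (.cons hx hρ) hB) _ .id (h₁.toETyping.hasTy_den hρ) hn.2.2

/-! ### The size of hereditarily sequential values -/

theorem Tree.mapFold_of_degree {P : Poly} {g : Tree → Tree} {Q : Poly} (hQ : Q.degree = 0) :
    ∀ t : Tree, t.mapFold P g Q = t := by
  induction Q <;> intro t <;> cases t <;> simp_all [Poly.degree, Tree.mapFold]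

theorem Poly.app_of_degree {Q : Poly} (hQ : Q.degree = 0) (γ δ : Ground) :
    Q.app γ = Q.app δ := by
  induction Q <;> simp_all [Poly.degree, Poly.app]

/-- The functions `F` that add the number of constructors to a safe counter. -/
def AddsConCount (γ : Ground) : Prop :=
  ∃ F, RSFun (.prod γ (.safeMu natPoly)) (.safeMu natPoly) F ∧
    ∀ t s, t.HasTy γ → F (.pair t (natTree s)) = natTree (s + t.conCount)

theorem AddsConCount.unit : AddsConCount .unit := by
  refine ⟨_, (RSFun.id (γ := .prod .unit (.safeMu natPoly)) ⟨trivial, admissible_nat⟩).snd,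
    fun t s ht => ?_⟩
  obtain rfl := Tree.hasTy_unit_iff.1 ht
  rfl

theorem AddsConCount.sum {γ₁ γ₂ : Ground} (h₁ : AddsConCount γ₁) (h₂ : AddsConCount γ₂)
    (hγ : (Ground.sum γ₁ γ₂).Admissible) : AddsConCount (.sum γ₁ γ₂) := by
  obtain ⟨F₁, hF₁, hF₁'⟩ := h₁
  obtain ⟨F₂, hF₂, hF₂'⟩ := h₂
  have hadm : (Ground.prod (.sum γ₁ γ₂) (.safeMu natPoly)).Admissible := ⟨hγ, admissible_nat⟩
  have hid₁ := RSFun.id (γ := .prod γ₁ (.prod (.sum γ₁ γ₂) (.safeMu natPoly))) ⟨hγ.1, hadm⟩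
  have hid₂ := RSFun.id (γ := .prod γ₂ (.prod (.sum γ₁ γ₂) (.safeMu natPoly))) ⟨hγ.2, hadm⟩
  refine ⟨_, RSFun.caseOf hadm (.inr trivial) (RSFun.id hadm).fst
    (hF₁.comp (hid₁.fst.pair hid₁.snd.snd)) (hF₂.comp (hid₂.fst.pair hid₂.snd.snd)),
    fun t s ht => ?_⟩
  obtain ⟨u, rfl, hu⟩ | ⟨u, rfl, hu⟩ := Tree.hasTy_sum_iff.1 ht
  · exact hF₁' u s hu
  · exact hF₂' u s hu

/-- The counter passes through one component and then the other as an accumulator, so no two safe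
numerals are added. -/
theorem AddsConCount.prod {γ₁ γ₂ : Ground} (h₁ : AddsConCount γ₁) (h₂ : AddsConCount γ₂)
    (hγ : (Ground.prod γ₁ γ₂).Admissible) : AddsConCount (.prod γ₁ γ₂) := by
  obtain ⟨F₁, hF₁, hF₁'⟩ := h₁
  obtain ⟨F₂, hF₂, hF₂'⟩ := h₂
  have hid := RSFun.id (γ := .prod (.prod γ₁ γ₂) (.safeMu natPoly)) ⟨hγ, admissible_nat⟩
  refine ⟨_, hF₂.comp (hid.fst.snd.pair (hF₁.comp (hid.fst.fst.pair hid.snd))), fun t s ht => ?_⟩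
  obtain ⟨u, v, rfl, hu, hv⟩ := Tree.hasTy_prod_iff.1 ht
  simp only [Tree.fst, Tree.snd, hF₁' u s hu, hF₂' v _ hv, Tree.conCount, Nat.add_assoc]

/-- Given the counter after the only recursive call in a tree of type `Q(μ P)`, the other
constructors of the tree can be added to the counter. -/
def AddsConCountStep (P Q : Poly) : Prop :=
  ∃ F, RSFun (.prod (Q.app (.safeMu natPoly)) (.safeMu natPoly)) (.safeMu natPoly) F ∧
    ∀ (g : Tree → Tree) (t : Tree) (s : ℕ), t.HasTy (Q.app (.mu P)) →
      (∀ u : Tree, sizeOf u ≤ sizeOf t → u.HasTy (.mu P) →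
        u.mapFold P g .id = natTree (s + u.conCount)) →
      F (.pair (t.mapFold P g Q) (natTree s)) = natTree (s + t.conCount)

theorem AddsConCount.step {Q : Poly} (hQ : Q.degree = 0) (P : Poly)
    (h : AddsConCount (Q.app .unit)) : AddsConCountStep P Q := by
  obtain ⟨F, hF, hF'⟩ := h
  rw [Poly.app_of_degree hQ .unit (.safeMu natPoly)] at hF
  refine ⟨F, hF, fun g t s ht _ => ?_⟩
  rw [Tree.mapFold_of_degree hQ]
  exact hF' t s (by rwa [Poly.app_of_degree hQ .unit (.mu P)])

theorem AddsConCountStep.sum {P Q₁ Q₂ : Poly} (h₁ : AddsConCountStep P Q₁)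
    (h₂ : AddsConCountStep P Q₂) (hQ : (Poly.sum Q₁ Q₂).ConstsInhabited) :
    AddsConCountStep P (.sum Q₁ Q₂) := by
  obtain ⟨F₁, hF₁, hF₁'⟩ := h₁
  obtain ⟨F₂, hF₂, hF₂'⟩ := h₂
  have hc₁ : (Q₁.app (.safeMu natPoly)).Admissible := hQ.1.admissible_app admissible_nat
  have hc₂ : (Q₂.app (.safeMu natPoly)).Admissible := hQ.2.admissible_app admissible_nat
  have hadm : (Ground.prod ((Poly.sum Q₁ Q₂).app (.safeMu natPoly)) (.safeMu natPoly)).Admissible :=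
    ⟨⟨hc₁, hc₂⟩, admissible_nat⟩
  have hid₁ := RSFun.id (γ := .prod (Q₁.app (.safeMu natPoly)) _) ⟨hc₁, hadm⟩
  have hid₂ := RSFun.id (γ := .prod (Q₂.app (.safeMu natPoly)) _) ⟨hc₂, hadm⟩
  refine ⟨_, RSFun.caseOf hadm (.inr trivial) (RSFun.id hadm).fst
    (hF₁.comp (hid₁.fst.pair hid₁.snd.snd)) (hF₂.comp (hid₂.fst.pair hid₂.snd.snd)),
    fun g t s ht hg => ?_⟩
  obtain ⟨u, rfl, hu⟩ | ⟨u, rfl, hu⟩ := Tree.hasTy_sum_iff.1 ht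
  · exact hF₁' g u s hu fun x hx => hg x (hx.trans (by simp))
  · exact hF₂' g u s hu fun x hx => hg x (hx.trans (by simp))

/-- The component at `Q₂` is left unchanged by the fold and can be counted as ordinary data. It must
be counted after `Q₁`: at a recursive position the incoming counter is discarded in favour of the
recursive result. -/
theorem AddsConCountStep.prod_left {P Q₁ Q₂ : Poly} (h₁ : AddsConCountStep P Q₁)
    (h₂ : AddsConCount (Q₂.app .unit)) (hd : Q₂.degree = 0)
    (hQ : (Poly.prod Q₁ Q₂).ConstsInhabited) : AddsConCountStep P (.prod Q₁ Q₂) := by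
  obtain ⟨F₁, hF₁, hF₁'⟩ := h₁
  obtain ⟨F₂, hF₂, hF₂'⟩ := h₂
  rw [Poly.app_of_degree hd .unit (.safeMu natPoly)] at hF₂
  have hid := RSFun.id (γ := .prod ((Poly.prod Q₁ Q₂).app (.safeMu natPoly)) (.safeMu natPoly))
    ⟨hQ.admissible_app admissible_nat, admissible_nat⟩
  refine ⟨_, hF₂.comp (hid.fst.snd.pair (hF₁.comp (hid.fst.fst.pair hid.snd))),
    fun g t s ht hg => ?_⟩
  obtain ⟨u, v, rfl, hu, hv⟩ := Tree.hasTy_prod_iff.1 ht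
  rw [Poly.app_of_degree hd _ .unit] at hv
  simp only [Tree.fst, Tree.snd, Tree.mapFold, Tree.mapFold_of_degree hd, hF₂' v _ hv,
    hF₁' g u s hu fun x hx => hg x (hx.trans (by simp only [Tree.pair.sizeOf_spec]; omega)),
    Tree.conCount, Nat.add_assoc]

theorem AddsConCountStep.prod_right {P Q₁ Q₂ : Poly} (h₁ : AddsConCount (Q₁.app .unit))
    (h₂ : AddsConCountStep P Q₂) (hd : Q₁.degree = 0)
    (hQ : (Poly.prod Q₁ Q₂).ConstsInhabited) : AddsConCountStep P (.prod Q₁ Q₂) := by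
  obtain ⟨F₁, hF₁, hF₁'⟩ := h₁
  obtain ⟨F₂, hF₂, hF₂'⟩ := h₂
  rw [Poly.app_of_degree hd .unit (.safeMu natPoly)] at hF₁
  have hid := RSFun.id (γ := .prod ((Poly.prod Q₁ Q₂).app (.safeMu natPoly)) (.safeMu natPoly))
    ⟨hQ.admissible_app admissible_nat, admissible_nat⟩
  refine ⟨_, hF₁.comp (hid.fst.fst.pair (hF₂.comp (hid.fst.snd.pair hid.snd))),
    fun g t s ht hg => ?_⟩
  obtain ⟨u, v, rfl, hu, hv⟩ := Tree.hasTy_prod_iff.1 ht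
  rw [Poly.app_of_degree hd _ .unit] at hu
  simp only [Tree.fst, Tree.snd, Tree.mapFold, Tree.mapFold_of_degree hd, hF₁' u _ hu,
    hF₂' g v s hv fun x hx => hg x (hx.trans (by simp only [Tree.pair.sizeOf_spec]; omega)),
    Tree.conCount, Nat.add_assoc, Nat.add_comm u.conCount]

/-- The initial counter is a parameter of the fold: a step without recursive call starts from it,
any other continues from the recursive result. The successor accounts for the constructor itself. -/
theorem AddsConCount.mu {P : Poly} (h : AddsConCountStep P P) (hP : (Ground.mu P).Admissible) :
    AddsConCount (.mu P) := by
  obtain ⟨F, hF, hF'⟩ := h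
  have hadm : (Ground.prod (.mu P) (.safeMu natPoly)).Admissible := ⟨hP, admissible_nat⟩
  have hid := RSFun.id (γ := .prod (P.app (.safeMu natPoly)) _)
    ⟨hP.2.admissible_app admissible_nat, hadm⟩
  refine ⟨_, RSFun.fold hadm trivial (RSFun.id hadm).fst
    (hF.comp (hid.fst.pair hid.snd.snd)).natSucc, fun t s ht => ?_⟩
  simp only [Tree.fst, Tree.snd]
  generalize hk : sizeOf t = k
  induction k using Nat.strong_induction_on generalizing t with
  | _ k ih =>
    obtain ⟨u, rfl, hu⟩ := Tree.hasTy_mu_iff.1 ht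
    simp only [Tree.mapFold]
    rw [hF' _ u s hu fun x hx hx' => ih _ ?_ x hx' rfl]
    · rfl
    · simp only [Tree.con.sizeOf_spec] at hk
      omega

/-- Sequentiality enters here: in a product of degree at most 1, one factor has degree 0. The two
claims are proved together, because a product step needs the plain count of its constant factor, and
a constant functor at `μ R` needs the step for `R`. -/
theorem Poly.addsConCount (Q : Poly) (hs : Q.ConstsSequential) (hi : Q.ConstsInhabited) :
    (Q.degree = 0 → AddsConCount (Q.app .unit)) ∧
      (Q.degree ≤ 1 → ∀ P, AddsConCountStep P Q) := by
  induction Q with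
  | id =>
    refine ⟨by simp [Poly.degree], fun _ P => ⟨_, (RSFun.id (γ := .prod (.safeMu natPoly)
      (.safeMu natPoly)) ⟨admissible_nat, admissible_nat⟩).fst, fun g t s ht hg => ?_⟩⟩
    exact hg t le_rfl ht
  | constUnit => exact ⟨fun _ => .unit, fun _ P => AddsConCount.step (Q := .constUnit) rfl P .unit⟩
  | constMu R ih =>
    have h := AddsConCount.mu ((ih hs.2 hi.2).2 hs.1 R) hi
    exact ⟨fun _ => h, fun _ P => AddsConCount.step (Q := .constMu R) rfl P h⟩
  | sum Q₁ Q₂ ih₁ ih₂ =>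
    have ih₁ := ih₁ hs.1 hi.1
    have ih₂ := ih₂ hs.2 hi.2
    simp only [Poly.degree, Nat.max_eq_zero_iff, max_le_iff]
    exact ⟨fun h => (ih₁.1 h.1).sum (ih₂.1 h.2) (hi.admissible_app (γ := .unit) trivial),
      fun h P => (ih₁.2 h.1 P).sum (ih₂.2 h.2 P) hi⟩
  | prod Q₁ Q₂ ih₁ ih₂ =>
    have ih₁ := ih₁ hs.1 hi.1
    have ih₂ := ih₂ hs.2 hi.2
    simp only [Poly.degree, Nat.add_eq_zero_iff]
    refine ⟨fun h => (ih₁.1 h.1).prod (ih₂.1 h.2) (hi.admissible_app (γ := .unit) trivial),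
      fun h P => ?_⟩
    obtain hd | hd : Q₁.degree = 0 ∨ Q₂.degree = 0 := by omega
    · exact AddsConCountStep.prod_right (ih₁.1 hd) (ih₂.2 (by omega) P) hd hi
    · exact AddsConCountStep.prod_left (ih₁.2 (by omega) P) (ih₂.1 hd) hd hi

theorem Ground.addsConCount {γ : Ground} (hn : γ.IsNormal) (ha : γ.Admissible)
    (hs : γ.HereditarilySequential) : AddsConCount γ := by
  induction γ with
  | unit => exact .unit
  | mu P => exact .mu ((P.addsConCount hs.2 ha.2).2 hs.1 P) ha
  | safeUnit | safeMu P => exact hn.elim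
  | sum γ₁ γ₂ ih₁ ih₂ => exact (ih₁ hn.1 ha.1 hs.1).sum (ih₂ hn.2 ha.2 hs.2) ha
  | prod γ₁ γ₂ ih₁ ih₂ => exact (ih₁ hn.1 ha.1 hs.1).prod (ih₂ hn.2 ha.2 hs.2) ha

/-! ### Assembly: the clock and the final term. -/

theorem polynomial_eval_mono (q : Polynomial ℕ) {m n : ℕ} (h : m ≤ n) :
    q.eval m ≤ q.eval n := by
  simp only [Polynomial.eval_eq_sum, Polynomial.sum]
  gcongr

/-- The completeness theorem for hereditarily sequential arguments. -/
theorem TDPolyCost.rsComputable {f : Term} {γ₁ γ₀ : Ground} (hf : STyping [] f (.arrow γ₁ γ₀))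
    (hnormal : γ₁.IsNormal) (hseq : γ₁.HereditarilySequential) (hcost : TDPolyCost f γ₁) :
    RSComputable f γ₁ γ₀ := by
  obtain ⟨⟨-, hadm⟩, hnormal₀, hadm₀⟩ := hf.isSType
  obtain ⟨q, hq⟩ := hcost
  have happ : STyping [γ₁] (.app f (.var 0)) (.ground γ₀) :=
    .app (hf.append [γ₁]) (.var ⟨hnormal, hadm⟩ rfl)
  obtain ⟨F, hF, hF'⟩ := happ.exists_rsFun (by simpa using hadm)
  obtain ⟨C, hC, hC'⟩ := Ground.addsConCount hnormal hadm hseq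
  obtain ⟨K, hK, hK'⟩ := RSFun.polynomial q
  have hid := RSFun.id hadm
  -- The clock is `q` at the constructor count of the argument, with the counter started at 0.
  have hclock := hK.comp ((hC.comp (hid.pair (RSFun.const (δ := .safeMu natPoly)
    (t := natTree 0) admissible_nat (hasTy_safe_natTree 0)))).toNormal hnormal)
  -- The safe copy of the argument, closed by a safe unit, is the tuple of the one-variable
  -- environment. The result becomes normal again since the argument is.
  have hmain := (hF.comp (hclock.pair (hid.toSafe.pair RSFun.unit.toSafe))).toNormal hnormal
  obtain ⟨e, he, hden⟩ := hmain
  have he : RSTyping [γ₁] e (.ground γ₀) := by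
    simpa only [Ty.result, Ground.toNormal_toSafe hnormal₀] using he
  refine ⟨.lam e, .lam hadm he, fun h a ha => ?_⟩
  obtain ⟨t, hr, ht⟩ := ha.exists_rep
  have hρ : EnvTy [t] [γ₁] := .cons ht .nil
  have hθ : EnvRep h [a] id [t] := by
    intro i u hi
    cases i <;> simp_all
  have hlam : RSTyping [γ₁] (.app (.lam e) (.var 0)) (.ground γ₀) :=
    .app ((RSTyping.lam (Γ := []) hadm he).append [γ₁]) (.var hadm rfl)
  have hren (e : Term) : e.rename id = e := by
    have lift : liftRen id = id := by funext i; cases i <;> rfl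
    induction e <;> simp_all [Term.rename]
  obtain ⟨v, k, n, hd, -, hv, hn⟩ := happ.toETyping.evaluatesAt id [a] h [t] hρ hθ
  obtain ⟨v', k', n', hd', -, hv', -⟩ := hlam.toETyping.evaluatesAt id [a] h [t] hρ hθ
  rw [hren] at hd hd'
  refine ⟨v, k, n, v', k', n', hd, hd', hv.bisim ?_ (happ.toETyping.hasTy_den hρ) hnormal₀⟩
  obtain ⟨w, l, m, hm, hmq⟩ := hq h a ha
  obtain ⟨-, -, rfl⟩ := hd.unique hm
  -- The chain is `foldBound` ≤ cost ≤ `q` at the graph size ≤ `q` at the tree count, the last being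
  -- the value of the clock.
  have hbound := hn.trans (hmq.trans (polynomial_eval_mono q hr.size_le))
  have hval : Term.den (.app (.lam e) (.var 0)) [t] = Term.den (.app f (.var 0)) [t] := by
    rw [← hF' _ [t] hρ hbound]
    refine (he.toETyping.den_append [t] (ρ := [t]) rfl).trans ((hden t ht).trans ?_)
    simp only [hC' t 0 ht, hK', Nat.zero_add]
    rfl
  rwa [hval] at hv'

end StructRec

theorem theoremt (f : StructRec.Term) (γ₁ γ₀ : StructRec.Ground)
    (hf : StructRec.STyping [] f (.arrow γ₁ γ₀))
    (hnormal : γ₁.IsNormal) (hseq : γ₁.HereditarilySequential)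
    (hcost : StructRec.TDPolyCost f γ₁) :
    StructRec.RSComputable f γ₁ γ₀ := by
  exact hcost.rsComputable hf hnormal hseq
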